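/- Let $A\in\mathbb{R}^{n\times n}$, $B\in\mathbb{R}^{n\times m}$, $K_0\in\mathbb{R}^{m\times n}$, and consider the system $$x(t+1)=Ax(t)+Bu(t)+w(t),\qquad u(t)=K_0x(t)+v(t),\qquad t=0,1,2,\dots$$ The coordinates of the disturbances $w(t)\in\mathbb{R}^n$ and of the input noises $v(t)\in\mathbb{R}^m$, $t\in\mathbb{Z}$, are jointly independent, centered and sub-Gaussian; the variance of each coordinate does not depend on $t$, and it is nonzero for the coordinates of $v$. For a random variable $X$ put $\|X\|_\psi=\inf\{r>0:\mathbb{E}\exp(X^2/r^2)\le 2\}$, and let $\eta>0$ be such that $\|w_i(t)\|_\psi\le\eta$ and $\|v_i(t)\|_\psi\le\eta$ for all $t,i$. Let $C\ge 1$ and $0\le\rho<1$ be such that, with $F=A+BK_0$, the spectral norms of $F^\tau$, $F^\tau B$, $K_0F^\tau$ and $K_0F^\tau B$ are at most $C\rho^\tau$ for all integers $\tau\ge 0$. The initial state is stationary: almost surely $x(0)=\lim_{N\to\infty}\sum_{\tau=-N}^{-1}F^{-\tau-1}(w(\tau)+Bv(\tau))$. Let $M^*$ be the covariance matrix of the vector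 $(x(0),u(0))\in\mathbb{R}^{n+m}$. Let $\Psi^*=[A\ B]^\top\in\mathbb{R}^{(n+m)\times n}$, let $\mathcal{A}_j=\{i:\Psi^*_{ij}\ne0\}$, and let $k=\max_j|\mathcal{A}_j|$. Suppose that there are constants $0<\gamma<1$, $0<C_{\min}\le1$, $D_{\max}\ge1$ and $0<\Psi_{\min}\le1$ such that for every $j\in\{1,\dots,n\}$: (A1) $\|M^*_{i\mathcal{A}_j}(M^*_{\mathcal{A}_j\mathcal{A}_j})^{-1}\|_1\le1-\gamma$ for all $i\notin\mathcal{A}_j$; (A2) every eigenvalue of $M^*_{\mathcal{A}_j\mathcal{A}_j}$ is at least $C_{\min}$; (A3) the largest absolute row sum of $(M^*_{\mathcal{A}_j\mathcal{A}_j})^{-1}$ is at most $D_{\max}$; (A4) $|\Psi^*_{ij}|\ge\Psi_{\min}$ for all $i\in\mathcal{A}_j$. There are universal constants $c_1,c_2,c_3>0$ such that the following holds in this setting. Let $k\ge2$ and $0<\delta<1$, and suppose that $$\lambda=c_1\,\frac{C}{1-\rho}\,\frac{\eta^2}{\gamma}\sqrt{\frac{\log((n+m)/\delta)}{T}},\qquad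 T\ge c_2\,\frac{C^4}{(1-\rho)^4}\cdot\frac{\eta^4D_{\max}^2}{\gamma^2C_{\min}^2\Psi_{\min}^2}\,k^2\log((n+m)/\delta).$$ Let $Y$ be the $T\times n$ matrix with rows $x(1)^\top,\dots,x(T)^\top$, and let $X$ be the $T\times(n+m)$ matrix with rows $(x(t)^\top,u(t)^\top)$, $t=0,\dots,T-1$. Then, with probability at least $1-\delta$, the Lasso problem $$\min_{\Psi\in\mathbb{R}^{(n+m)\times n}}\ \frac1{2T}\|Y-X\Psi\|_F^2+\lambda\sum_{i,j}|\Psi_{ij}|$$ has a unique solution $\hat\Psi$, this solution has exactly the same sparsity pattern as $\Psi^*$, and $$\max_{i,j}|\hat\Psi_{ij}-\Psi^*_{ij}|\le c_3\,\frac{C}{1-\rho}\cdot\frac{D_{\max}\eta^2}{\gamma}\sqrt{\frac{\log((n+m)/\delta)}{T}}.$$ -/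

import Mathlib

open MeasureTheory ProbabilityTheory Filter Topology

noncomputable section

namespace SparseLTI

/-- Induced spectral norm of a real matrix (Euclidean operator norm). -/
def specNorm {α β : Type*} [Fintype α] [Fintype β] [DecidableEq α] [DecidableEq β]
    (M : Matrix α β ℝ) : ℝ :=
  Matrix.instL2OpNormedAddCommGroup.norm M

/-- Induced infinity norm of a real matrix (largest absolute row sum). -/
def infOpNorm {α β : Type*} [Fintype α] [Fintype β] (M : Matrix α β ℝ) : ℝ :=
  Matrix.linftyOpNormedAddCommGroup.norm M

/-- Sub-Gaussian norm: the infimum of all `r > 0` with `𝔼 exp (X² / r²) ≤ 2`. -/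
def subGaussianNorm {Ω : Type*} [MeasurableSpace Ω] (X : Ω → ℝ) (μ : Measure Ω) : ℝ :=
  sInf {r : ℝ | 0 < r ∧ ∫⁻ ω, ENNReal.ofReal (Real.exp (X ω ^ 2 / r ^ 2)) ∂μ ≤ 2}

/-- A centered random variable that is sub-Gaussian with some parameter `b` (here `c = b²`). -/
def IsCenteredSubGaussian {Ω : Type*} [MeasurableSpace Ω] (X : Ω → ℝ) (μ : Measure Ω) : Prop :=
  ∫ ω, X ω ∂μ = 0 ∧ ∃ c : NNReal, HasSubgaussianMGF X c μ

/-- The disturbance `w` and the input noise `v`, indexed by all integer times: all coordinates at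
all times are jointly independent, centered and sub-Gaussian, each coordinate has a variance that
does not change with time, and the coordinates of `v` have nonzero variance. -/
structure IsNoise {Ω : Type*} [MeasurableSpace Ω] (μ : Measure Ω) {n m : ℕ}
    (w : ℤ → Ω → Fin n → ℝ) (v : ℤ → Ω → Fin m → ℝ) : Prop where
  measurable_w : ∀ t i, Measurable fun ω => w t ω i
  measurable_v : ∀ t i, Measurable fun ω => v t ω i
  indep : iIndepFun
    (fun (p : ℤ × (Fin n ⊕ Fin m)) (ω : Ω) => Sum.elim (w p.1 ω) (v p.1 ω) p.2) μ
  subGaussian_w : ∀ t i, IsCenteredSubGaussian (fun ω => w t ω i) μ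
  subGaussian_v : ∀ t i, IsCenteredSubGaussian (fun ω => v t ω i) μ
  variance_w : ∀ t i, variance (fun ω => w t ω i) μ = variance (fun ω => w 0 ω i) μ
  variance_v : ∀ t i, variance (fun ω => v t ω i) μ = variance (fun ω => v 0 ω i) μ
  variance_v_pos : ∀ t i, 0 < variance (fun ω => v t ω i) μ

/-- `(x, u)` is the trajectory of `x (t+1) = A x t + B u t + w t` under the feedback
`u t = K₀ x t + v t`, started from the stationary initial state
`x 0 = lim_N ∑_{τ = -N}^{-1} (A + B K₀) ^ (-τ-1) (w τ + B v τ)` (substitute `τ = -(s+1)`). -/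
structure IsStationaryTrajectory {Ω : Type*} [MeasurableSpace Ω] (μ : Measure Ω) {n m : ℕ}
    (A : Matrix (Fin n) (Fin n) ℝ) (B : Matrix (Fin n) (Fin m) ℝ) (K₀ : Matrix (Fin m) (Fin n) ℝ)
    (w : ℤ → Ω → Fin n → ℝ) (v : ℤ → Ω → Fin m → ℝ)
    (x : ℕ → Ω → Fin n → ℝ) (u : ℕ → Ω → Fin m → ℝ) : Prop where
  initial : ∀ᵐ ω ∂μ, Tendsto
    (fun N : ℕ => ∑ s ∈ Finset.range N,
      ((A + B * K₀) ^ s).mulVec (w (-((s : ℤ) + 1)) ω + B.mulVec (v (-((s : ℤ) + 1)) ω)))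
    atTop (𝓝 (x 0 ω))
  feedback : ∀ t ω, u t ω = K₀.mulVec (x t ω) + v t ω
  dynamics : ∀ t ω, x (t + 1) ω = A.mulVec (x t ω) + B.mulVec (u t ω) + w t ω

/-- Exponential stability of the closed loop, with constants `C ≥ 1` and `0 ≤ ρ < 1`. -/
structure IsExpStable {n m : ℕ} (A : Matrix (Fin n) (Fin n) ℝ) (B : Matrix (Fin n) (Fin m) ℝ)
    (K₀ : Matrix (Fin m) (Fin n) ℝ) (C ρ : ℝ) : Prop where
  one_le_C : 1 ≤ C
  rho_nonneg : 0 ≤ ρ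
  rho_lt_one : ρ < 1
  bound : ∀ τ : ℕ, specNorm ((A + B * K₀) ^ τ) ≤ C * ρ ^ τ
  bound_B : ∀ τ : ℕ, specNorm ((A + B * K₀) ^ τ * B) ≤ C * ρ ^ τ
  bound_K : ∀ τ : ℕ, specNorm (K₀ * (A + B * K₀) ^ τ) ≤ C * ρ ^ τ
  bound_KB : ∀ τ : ℕ, specNorm (K₀ * (A + B * K₀) ^ τ * B) ≤ C * ρ ^ τ

/-- The true parameter `Ψ* = [A B]ᵀ`. -/
def trueParam {n m : ℕ} (A : Matrix (Fin n) (Fin n) ℝ) (B : Matrix (Fin n) (Fin m) ℝ) :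
    Matrix (Fin n ⊕ Fin m) (Fin n) ℝ :=
  (Matrix.fromCols A B).transpose

open Classical in
/-- The set `𝒜_j` of positions of the nonzero entries of the `j`-th column. -/
def colSupport {n m : ℕ} (Ψ : Matrix (Fin n ⊕ Fin m) (Fin n) ℝ) (j : Fin n) :
    Finset (Fin n ⊕ Fin m) :=
  Finset.univ.filter fun i => Ψ i j ≠ 0

/-- The maximum number of nonzero entries in any column. -/
def maxColNnz {n m : ℕ} (Ψ : Matrix (Fin n ⊕ Fin m) (Fin n) ℝ) : ℕ :=
  Finset.univ.sup fun j => (colSupport Ψ j).card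

/-- The covariance matrix `M*` of the random vector `(x 0, u 0)`. -/
def stationaryCov {Ω : Type*} [MeasurableSpace Ω] (μ : Measure Ω) {n m : ℕ}
    (x : ℕ → Ω → Fin n → ℝ) (u : ℕ → Ω → Fin m → ℝ) :
    Matrix (Fin n ⊕ Fin m) (Fin n ⊕ Fin m) ℝ :=
  fun i j => covariance (fun ω => Sum.elim (x 0 ω) (u 0 ω) i)
    (fun ω => Sum.elim (x 0 ω) (u 0 ω) j) μ

/-- The submatrix `M_{𝒮𝒮}`. -/
def principalSub {ι : Type*} (M : Matrix ι ι ℝ) (S : Finset ι) : Matrix S S ℝ :=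
  M.submatrix Subtype.val Subtype.val

/-- The mutual incoherence assumption on `M` and `Ψ`. -/
structure MutualIncoherence {n m : ℕ} (M : Matrix (Fin n ⊕ Fin m) (Fin n ⊕ Fin m) ℝ)
    (Ψ : Matrix (Fin n ⊕ Fin m) (Fin n) ℝ) (γ Cmin Dmax Ψmin : ℝ) : Prop where
  gamma_pos : 0 < γ
  gamma_lt_one : γ < 1
  Cmin_pos : 0 < Cmin
  Cmin_le_one : Cmin ≤ 1
  one_le_Dmax : 1 ≤ Dmax
  Psimin_pos : 0 < Ψmin
  Psimin_le_one : Ψmin ≤ 1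
  incoherence : ∀ j, ∀ i ∉ colSupport Ψ j,
    ∑ l, |Matrix.vecMul (fun a : colSupport Ψ j => M i a)
      (principalSub M (colSupport Ψ j))⁻¹ l| ≤ 1 - γ
  eigenvalue : ∀ j, ∀ e ∈ spectrum ℝ (principalSub M (colSupport Ψ j)), Cmin ≤ e
  infNorm : ∀ j, infOpNorm (principalSub M (colSupport Ψ j))⁻¹ ≤ Dmax
  gap : ∀ j, ∀ i ∈ colSupport Ψ j, Ψmin ≤ |Ψ i j|

/-- Observation matrix `Y`, with rows `x 1, …, x T`, for one realization of the trajectory. -/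
def obsMatrix {n : ℕ} (T : ℕ) (x : ℕ → Fin n → ℝ) : Matrix (Fin T) (Fin n) ℝ :=
  Matrix.of fun t => x (t + 1)

/-- Design matrix `X`, with rows `(x 0, u 0), …, (x (T-1), u (T-1))`. -/
def designMatrix {n m : ℕ} (T : ℕ) (x : ℕ → Fin n → ℝ) (u : ℕ → Fin m → ℝ) :
    Matrix (Fin T) (Fin n ⊕ Fin m) ℝ :=
  Matrix.of fun t => Sum.elim (x t) (u t)

/-- The objective `(1 / 2T) ‖Y - X Ψ‖_F² + lam ‖Ψ‖₁`. -/
def lassoObj {n m T : ℕ} (Y : Matrix (Fin T) (Fin n) ℝ) (X : Matrix (Fin T) (Fin n ⊕ Fin m) ℝ)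
    (lam : ℝ) (Ψ : Matrix (Fin n ⊕ Fin m) (Fin n) ℝ) : ℝ :=
  1 / (2 * (T : ℝ)) * ∑ t, ∑ j, (Y - X * Ψ) t j ^ 2 + lam * ∑ i, ∑ j, |Ψ i j|

/-- `Ψ` solves the Lasso problem. -/
def IsLassoSolution {n m T : ℕ} (Y : Matrix (Fin T) (Fin n) ℝ)
    (X : Matrix (Fin T) (Fin n ⊕ Fin m) ℝ) (lam : ℝ)
    (Ψ : Matrix (Fin n ⊕ Fin m) (Fin n) ℝ) : Prop :=
  ∀ Φ, lassoObj Y X lam Ψ ≤ lassoObj Y X lam Φ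

end SparseLTI

end

/-! The proof is a primal-dual witness argument carried out on an event of large probability.

Deterministic half. Suppose the empirical second moment matrix of (x, u) is entrywise within ε of
M*, and every empirical correlation of a coordinate of (x, u) with a coordinate of w is at most
γλ/4. For each column j, solve the stationarity equations of the Lasso restricted to 𝒜_j, with the
subgradient on 𝒜_j fixed to the signs of Ψ*. If D_max k ε ≤ γ/8, the restricted empirical matrix
stays invertible and half of the incoherence survives (`exists_solution_of_entrywise_close`). Hence
entries move by at most (5/2) D_max λ, which is below Ψ_min, so the signs are consistent, and off
the support the gradient is strictly below λ. Such a certificate pins down the unique minimizer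
(`isLassoSolution_iff_of_certificate`, `lasso_support_recovery`).

Probabilistic half. Each coordinate of (x, u) is a causal moving average of the noise whose
coefficient vectors have Euclidean norms summing to at most 3C/(1-ρ). A product of two moving
averages expands into products of noise forms at a pair of lags (p, q). For a fixed pair, summands
at distinct times share noise only if the times differ by |p-q|, so the times split into two classes
of independent sub-exponential summands (`lintegral_exp_sum_lagged_le`). Jensen's inequality over
all lag pairs, weighted by coefficient norms, needs no independence between pairs and costs only the
total mass (`lintegral_exp_weighted_sum_le`); Fatou reaches the infinite sums. A Chernoff bound
(`measure_abs_sum_mul_ge_le`) then gives deviations of order η²(C/(1-ρ))²√(log((n+m)/δ)/T) for the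
second moments. For the correlations with w, which are centred because w(t) does not enter (x(t),
u(t)), only one factor C/(1-ρ) appears. A union bound over at most 2(n+m)² entries finishes. -/

namespace SparseLTI

/-! ### Sub-Gaussian variables and products of two of them -/

/-- The linear term vanishes in expectation for centred variables, leaving only the exponential of a
square. -/
lemma exp_le_add_exp_sq (x : ℝ) : Real.exp x ≤ x + Real.exp (x ^ 2) := by
  have h1 : x ^ 2 + 1 ≤ Real.exp (x ^ 2) := Real.add_one_le_exp _
  rcases le_or_gt |x| 1 with h | h
  · have := (abs_le.1 (Real.abs_exp_sub_one_sub_id_le h)).2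
    linarith
  · rcases lt_or_ge x 0 with h0 | h0
    · rw [abs_of_neg h0] at h
      have : Real.exp x ≤ 1 := Real.exp_le_one_iff.2 h0.le
      nlinarith
    · rw [abs_of_nonneg h0] at h
      have : Real.exp x ≤ Real.exp (x ^ 2) := Real.exp_le_exp.2 (by nlinarith)
      linarith

lemma exp_mul_le_one_add {α y : ℝ} (h0 : 0 ≤ α) (h1 : α ≤ 1) :
    Real.exp (α * y) ≤ 1 + α * (Real.exp y - 1) := by
  have := convexOn_exp.2 (Set.mem_univ y) (Set.mem_univ (0 : ℝ)) h0 (sub_nonneg.2 h1) (by ring)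
  simp only [smul_eq_mul, mul_zero, add_zero, Real.exp_zero, mul_one] at this
  linarith

variable {Ω : Type*} [MeasurableSpace Ω] {μ : Measure Ω}

lemma integrable_of_lintegral_ofReal_le {f : Ω → ℝ} (hf : AEMeasurable f μ) (h0 : ∀ ω, 0 ≤ f ω)
    {b : ENNReal} (hb : b ≠ ⊤) (h : ∫⁻ ω, ENNReal.ofReal (f ω) ∂μ ≤ b) : Integrable f μ := by
  refine ⟨hf.aestronglyMeasurable, ?_⟩
  rw [hasFiniteIntegral_iff_ofReal (ae_of_all _ h0)]
  exact h.trans_lt hb.lt_top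

lemma integral_le_of_lintegral_ofReal_le {f : Ω → ℝ} (hf : AEMeasurable f μ) (h0 : ∀ ω, 0 ≤ f ω)
    {b : ℝ} (hb : 0 ≤ b) (h : ∫⁻ ω, ENNReal.ofReal (f ω) ∂μ ≤ ENNReal.ofReal b) :
    ∫ ω, f ω ∂μ ≤ b := by
  rw [integral_eq_lintegral_of_nonneg_ae (ae_of_all _ h0) hf.aestronglyMeasurable]
  exact ENNReal.toReal_le_of_le_ofReal hb h

lemma lintegral_ofReal_le_of_integral_le {f : Ω → ℝ} (hf : Integrable f μ) (h0 : ∀ ω, 0 ≤ f ω)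
    {b : ℝ} (h : ∫ ω, f ω ∂μ ≤ b) :
    ∫⁻ ω, ENNReal.ofReal (f ω) ∂μ ≤ ENNReal.ofReal b := by
  rw [← ofReal_integral_eq_lintegral_ofReal hf (ae_of_all _ h0)]
  exact ENNReal.ofReal_le_ofReal h

/-- For t²r² ≤ 1, centring removes the linear term of e^y ≤ y + e^(y²), and convexity bounds the
rest by 1 + t²r². For t²r² > 1, Young's inequality tX ≤ t²r²/2 + X²/(2r²) is enough, since 𝔼
exp(X²/(2r²)) ≤ 3/2 ≤ exp(t²r²/2). Both cases give exp(t²r²), which is variance parameter 2r². -/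
lemma hasSubgaussianMGF_of_lintegral_exp_sq [IsProbabilityMeasure μ] {X : Ω → ℝ}
    (hX : ∀ t : ℝ, Integrable (fun ω => Real.exp (t * X ω)) μ) (hi : Integrable X μ)
    (h0 : ∫ ω, X ω ∂μ = 0)
    {r : ℝ} (hr : 0 < r) (h : ∫⁻ ω, ENNReal.ofReal (Real.exp (X ω ^ 2 / r ^ 2)) ∂μ ≤ 2)
    {c : NNReal} (hc : 2 * r ^ 2 ≤ c) : HasSubgaussianMGF X c μ := by
  refine ⟨hX, fun t => ?_⟩
  have hm : AEMeasurable (fun ω => Real.exp (X ω ^ 2 / r ^ 2)) μ := by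
    have := hi.aemeasurable
    fun_prop
  have hE : Integrable (fun ω => Real.exp (X ω ^ 2 / r ^ 2)) μ :=
    integrable_of_lintegral_ofReal_le hm (fun _ => (Real.exp_pos _).le) (by simp) h
  have hE2 : ∫ ω, Real.exp (X ω ^ 2 / r ^ 2) ∂μ ≤ 2 :=
    integral_le_of_lintegral_ofReal_le hm (fun _ => (Real.exp_pos _).le) (by norm_num)
      (by simpa using h)
  have key : mgf X μ t ≤ Real.exp (t ^ 2 * r ^ 2) := by
    rcases le_or_gt (t ^ 2 * r ^ 2) 1 with h1 | h1
    · have hb : ∀ ω, Real.exp (t * X ω) ≤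
          t * X ω + (1 + (t ^ 2 * r ^ 2) * (Real.exp (X ω ^ 2 / r ^ 2) - 1)) := by
        intro ω
        refine (exp_le_add_exp_sq _).trans (add_le_add_right ?_ _)
        have e : (t * X ω) ^ 2 = (t ^ 2 * r ^ 2) * (X ω ^ 2 / r ^ 2) := by field_simp
        rw [e]
        exact exp_mul_le_one_add (by positivity) h1
      have hint : Integrable (fun ω =>
          t * X ω + (1 + (t ^ 2 * r ^ 2) * (Real.exp (X ω ^ 2 / r ^ 2) - 1))) μ :=
        (hi.const_mul t).add
          ((integrable_const 1).add ((hE.sub (integrable_const 1)).const_mul _))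
      refine (integral_mono (hX t) hint hb).trans ?_
      have e1 : Integrable (fun ω => Real.exp (X ω ^ 2 / r ^ 2) - 1) μ :=
        hE.sub (integrable_const 1)
      have e2 : Integrable (fun ω => (t ^ 2 * r ^ 2) * (Real.exp (X ω ^ 2 / r ^ 2) - 1)) μ :=
        e1.const_mul _
      have e3 : Integrable (fun ω => 1 + (t ^ 2 * r ^ 2) * (Real.exp (X ω ^ 2 / r ^ 2) - 1)) μ :=
        (integrable_const 1).add e2
      rw [integral_add (hi.const_mul t) e3,
        integral_add (integrable_const 1) e2, integral_const_mul, integral_const_mul, h0,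
        integral_sub hE (integrable_const 1)]
      simp only [integral_const, probReal_univ, smul_eq_mul, mul_one, mul_zero, zero_add]
      have := Real.add_one_le_exp (t ^ 2 * r ^ 2)
      have : 0 ≤ t ^ 2 * r ^ 2 := by positivity
      nlinarith
    · have hb : ∀ ω, Real.exp (t * X ω) ≤
          Real.exp (t ^ 2 * r ^ 2 / 2) * (1 + 1 / 2 * (Real.exp (X ω ^ 2 / r ^ 2) - 1)) := by
        intro ω
        have : Real.exp (t * X ω) ≤
            Real.exp (t ^ 2 * r ^ 2 / 2) * Real.exp (1 / 2 * (X ω ^ 2 / r ^ 2)) := by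
          rw [← Real.exp_add, Real.exp_le_exp]
          have h2 : t * X ω = (t * r) * (X ω / r) := by field_simp
          have h3 : X ω ^ 2 / r ^ 2 = (X ω / r) ^ 2 := by rw [div_pow]
          rw [h2, h3]
          nlinarith [sq_nonneg (t * r - X ω / r)]
        refine this.trans ?_
        gcongr
        exact exp_mul_le_one_add (by norm_num) (by norm_num)
      have e1 : Integrable (fun ω => Real.exp (X ω ^ 2 / r ^ 2) - 1) μ :=
        hE.sub (integrable_const 1)
      have e2 : Integrable (fun ω => 1 / 2 * (Real.exp (X ω ^ 2 / r ^ 2) - 1)) μ :=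
        e1.const_mul _
      have e3 : Integrable (fun ω => 1 + 1 / 2 * (Real.exp (X ω ^ 2 / r ^ 2) - 1)) μ :=
        (integrable_const 1).add e2
      refine (integral_mono (hX t) (e3.const_mul _) hb).trans ?_
      rw [integral_const_mul, integral_add (integrable_const 1) e2, integral_const_mul,
        integral_sub hE (integrable_const 1)]
      simp only [integral_const, probReal_univ, smul_eq_mul, mul_one]
      have h4 : 1 + 1 / 2 * (∫ ω, Real.exp (X ω ^ 2 / r ^ 2) ∂μ - 1) ≤
          Real.exp (t ^ 2 * r ^ 2 / 2) := by
        have := Real.add_one_le_exp (t ^ 2 * r ^ 2 / 2)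
        linarith
      calc _ ≤ Real.exp (t ^ 2 * r ^ 2 / 2) * Real.exp (t ^ 2 * r ^ 2 / 2) := by gcongr
        _ = _ := by rw [← Real.exp_add]; congr 1; ring
  refine key.trans (Real.exp_le_exp.2 ?_)
  nlinarith [sq_nonneg t]

lemma lintegral_exp_mul_gaussian (s : ℝ) :
    ∫⁻ g, ENNReal.ofReal (Real.exp (s * g)) ∂(gaussianReal 0 1) =
      ENNReal.ofReal (Real.exp (s ^ 2 / 2)) := by
  have h := mgf_gaussianReal (p := gaussianReal 0 1) (X := id) (μ := 0) (v := 1)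
    (by simp) s
  rw [← ofReal_integral_eq_lintegral_ofReal (integrable_exp_mul_gaussianReal s)
    (ae_of_all _ fun _ => (Real.exp_pos _).le)]
  simp only [mgf, id] at h
  rw [h]
  simp

lemma lintegral_exp_sq_gaussian :
    ∫⁻ g, ENNReal.ofReal (Real.exp (g ^ 2 / 4)) ∂(gaussianReal 0 1) ≤ 2 := by
  rw [gaussianReal_of_var_ne_zero _ one_ne_zero, lintegral_withDensity_eq_lintegral_mul _
    (by fun_prop) (by fun_prop)]
  have : ∀ x : ℝ, (gaussianPDF 0 1 * fun g => ENNReal.ofReal (Real.exp (g ^ 2 / 4))) x =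
      ENNReal.ofReal ((√(2 * Real.pi))⁻¹ * Real.exp (-(1/4) * x ^ 2)) := by
    intro x
    simp only [Pi.mul_apply, gaussianPDF, gaussianPDFReal]
    rw [← ENNReal.ofReal_mul (by positivity), mul_assoc, ← Real.exp_add]
    simp only [NNReal.coe_one, mul_one, sub_zero]
    congr 3
    ring
  simp_rw [this]
  have hi : Integrable (fun x : ℝ => (√(2 * Real.pi))⁻¹ * Real.exp (-(1/4) * x ^ 2)) :=
    (integrable_exp_neg_mul_sq (by norm_num)).const_mul _
  rw [← ofReal_integral_eq_lintegral_ofReal hi (ae_of_all _ fun _ => by positivity),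
    integral_const_mul, integral_gaussian, ← ENNReal.ofReal_ofNat]
  apply ENNReal.ofReal_le_ofReal
  rw [inv_mul_le_iff₀ (by positivity)]
  rw [show (2 : ℝ) = √4 by rw [show (4 : ℝ) = 2 ^ 2 by norm_num]; simp]
  rw [← Real.sqrt_mul (by positivity)]
  apply Real.sqrt_le_sqrt
  have := Real.pi_pos
  rw [show (4 : ℝ) = 2 ^ 2 by norm_num, Real.sqrt_sq (by norm_num)]
  norm_num
  nlinarith

/-- Gaussian linearization: exp(s²/2) is the moment generating function at s of an independent
standard normal g. After Tonelli, the bound on X leaves 𝔼 exp(g²/4) = √2. -/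
lemma HasSubgaussianMGF.lintegral_exp_sq_le [IsProbabilityMeasure μ] {X : Ω → ℝ} {c : NNReal}
    (hX : HasSubgaussianMGF X c μ) (hc : 0 < c) :
    ∫⁻ ω, ENNReal.ofReal (Real.exp (X ω ^ 2 / (4 * c))) ∂μ ≤ 2 := by
  have hm := hX.aemeasurable
  have hc' : (0 : ℝ) < c := hc
  have hs : √(2 * (c : ℝ)) ^ 2 = 2 * c := Real.sq_sqrt (by positivity)
  calc ∫⁻ ω, ENNReal.ofReal (Real.exp (X ω ^ 2 / (4 * c))) ∂μ
      = ∫⁻ ω, ∫⁻ g, ENNReal.ofReal (Real.exp (X ω / √(2 * c) * g)) ∂(gaussianReal 0 1) ∂μ := by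
        refine lintegral_congr fun ω => ?_
        rw [lintegral_exp_mul_gaussian, div_pow, hs]
        congr 2
        field_simp
        norm_num
    _ = ∫⁻ g, ∫⁻ ω, ENNReal.ofReal (Real.exp (X ω / √(2 * c) * g)) ∂μ ∂(gaussianReal 0 1) := by
        apply lintegral_lintegral_swap
        have h1 : AEMeasurable (fun z : Ω × ℝ => X z.1) (μ.prod (gaussianReal 0 1)) :=
          hm.comp_quasiMeasurePreserving Measure.quasiMeasurePreserving_fst
        have h2 : AEMeasurable (fun z : Ω × ℝ => X z.1 / √(2 * c) * z.2)
            (μ.prod (gaussianReal 0 1)) := (h1.div_const _).mul measurable_snd.aemeasurable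
        exact (Real.measurable_exp.comp_aemeasurable h2).ennreal_ofReal
    _ ≤ ∫⁻ g, ENNReal.ofReal (Real.exp (g ^ 2 / 4)) ∂(gaussianReal 0 1) := by
        refine lintegral_mono fun g => ?_
        have h1 := hX.integrable_exp_mul (g / √(2 * c))
        have h2 := hX.mgf_le (g / √(2 * c))
        have e : ∀ ω, X ω / √(2 * c) * g = g / √(2 * c) * X ω := fun ω => by ring
        simp_rw [e]
        refine lintegral_ofReal_le_of_integral_le h1 (fun _ => (Real.exp_pos _).le) (h2.trans ?_)
        rw [div_pow, hs]
        apply le_of_eq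
        congr 1
        field_simp
        norm_num
    _ ≤ 2 := lintegral_exp_sq_gaussian

lemma IsCenteredSubGaussian.hasSubgaussianMGF [IsProbabilityMeasure μ] {X : Ω → ℝ}
    (hX : IsCenteredSubGaussian X μ) {η : ℝ} (hη : 0 < η) (h : subGaussianNorm X μ ≤ η)
    {c : NNReal} (hc : 8 * η ^ 2 ≤ c) : HasSubgaussianMGF X c μ := by
  obtain ⟨h0, c₀, hc₀⟩ := hX
  have h1 : HasSubgaussianMGF X (c₀ + 1) μ := by
    refine ⟨hc₀.integrable_exp_mul, fun t => (hc₀.mgf_le t).trans (Real.exp_le_exp.2 ?_)⟩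
    push_cast
    nlinarith [sq_nonneg t]
  -- The real infimum of an empty set is 0, so a bound on the norm says nothing until some
  -- admissible r is known. Qualitative sub-Gaussianity supplies one; c₀ + 1 keeps it positive.
  have hne : {r : ℝ | 0 < r ∧ ∫⁻ ω, ENNReal.ofReal (Real.exp (X ω ^ 2 / r ^ 2)) ∂μ ≤ 2}.Nonempty := by
    have hp : (0 : ℝ) < 4 * ((c₀ + 1 : NNReal) : ℝ) := by positivity
    refine ⟨√(4 * ((c₀ + 1 : NNReal) : ℝ)), Real.sqrt_pos.2 hp, ?_⟩
    rw [Real.sq_sqrt hp.le]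
    exact HasSubgaussianMGF.lintegral_exp_sq_le h1 (by positivity)
  -- No attainment of the infimum is needed: an admissible r < 2η suffices, and 2(2η)² = 8η² is the
  -- parameter.
  obtain ⟨r, ⟨hr0, hr⟩, hr2⟩ := exists_lt_of_csInf_lt hne
    (show sInf _ < 2 * η from lt_of_le_of_lt h (by linarith))
  exact hasSubgaussianMGF_of_lintegral_exp_sq hc₀.integrable_exp_mul hc₀.integrable h0 hr0 hr
    (by nlinarith)

/-- A centred product of two sub-Gaussian variables is sub-exponential. -/
lemma lintegral_exp_mul_centered_mul_le [IsProbabilityMeasure μ] {p q : Ω → ℝ}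
    (hp : AEMeasurable p μ) (hq : AEMeasurable q μ) {K : ℝ} (hK : 0 < K)
    (hp2 : ∫⁻ ω, ENNReal.ofReal (Real.exp (p ω ^ 2 / K)) ∂μ ≤ 2)
    (hq2 : ∫⁻ ω, ENNReal.ofReal (Real.exp (q ω ^ 2 / K)) ∂μ ≤ 2)
    {t : ℝ} (ht : |t| * K ≤ 1 / 2) :
    ∫⁻ ω, ENNReal.ofReal (Real.exp (t * (p ω * q ω - ∫ ω', p ω' * q ω' ∂μ))) ∂μ ≤
      ENNReal.ofReal (Real.exp (50 * (t * K) ^ 2)) := by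
  have hexp : ∀ {f : Ω → ℝ}, AEMeasurable f μ → AEMeasurable (fun ω => Real.exp (f ω)) μ :=
    fun hf => Real.measurable_exp.comp_aemeasurable hf
  have hmp : AEMeasurable (fun ω => Real.exp (p ω ^ 2 / K)) μ := hexp (by fun_prop)
  have hmq : AEMeasurable (fun ω => Real.exp (q ω ^ 2 / K)) μ := hexp (by fun_prop)
  have hip := integrable_of_lintegral_ofReal_le hmp (fun _ => (Real.exp_pos _).le) (by simp) hp2
  have hiq := integrable_of_lintegral_ofReal_le hmq (fun _ => (Real.exp_pos _).le) (by simp) hq2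
  have hp3 := integral_le_of_lintegral_ofReal_le hmp (fun _ => (Real.exp_pos _).le)
    (by norm_num) (b := 2) (by simpa using hp2)
  have hq3 := integral_le_of_lintegral_ofReal_le hmq (fun _ => (Real.exp_pos _).le)
    (by norm_num) (b := 2) (by simpa using hq2)
  set U : Ω → ℝ := fun ω => |p ω * q ω| / K with hU
  have hUm : AEMeasurable U μ := ((hp.mul hq).abs).div_const K
  have hU0 : ∀ ω, 0 ≤ U ω := fun ω => by positivity
  have hUle : ∀ ω, Real.exp (U ω) ≤
      1 / 2 * Real.exp (p ω ^ 2 / K) + 1 / 2 * Real.exp (q ω ^ 2 / K) := by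
    intro ω
    have h1 : U ω ≤ 1 / 2 * (p ω ^ 2 / K) + 1 / 2 * (q ω ^ 2 / K) := by
      simp only [hU, abs_mul]
      rw [← sub_nonneg]
      have : 1 / 2 * (p ω ^ 2 / K) + 1 / 2 * (q ω ^ 2 / K) - |p ω| * |q ω| / K =
        (|p ω| - |q ω|) ^ 2 / (2 * K) := by
        rw [sub_sq, sq_abs, sq_abs]; field_simp; ring
      rw [this]; positivity
    refine (Real.exp_le_exp.2 h1).trans ?_
    exact convexOn_exp.2 (Set.mem_univ _) (Set.mem_univ _) (by norm_num) (by norm_num) (by norm_num)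
  have hbi : Integrable
      (fun ω => 1 / 2 * Real.exp (p ω ^ 2 / K) + 1 / 2 * Real.exp (q ω ^ 2 / K)) μ :=
    (hip.const_mul _).add (hiq.const_mul _)
  have hUi : Integrable (fun ω => Real.exp (U ω)) μ :=
    hbi.mono' (hexp hUm).aestronglyMeasurable (ae_of_all _ fun ω => by
      rw [Real.norm_eq_abs, abs_of_pos (Real.exp_pos _)]; exact hUle ω)
  have hEU : ∫ ω, Real.exp (U ω) ∂μ ≤ 2 := by
    refine (integral_mono hUi hbi hUle).trans ?_
    rw [integral_add (hip.const_mul _) (hiq.const_mul _), integral_const_mul, integral_const_mul]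
    linarith
  have hUi1 : Integrable U μ := hUi.mono' hUm.aestronglyMeasurable (ae_of_all _ fun ω => by
    rw [Real.norm_eq_abs, abs_of_nonneg (hU0 ω)]
    linarith [Real.add_one_le_exp (U ω)])
  have hEU1 : ∫ ω, U ω ∂μ ≤ 1 := by
    have : ∫ ω, U ω ∂μ ≤ ∫ ω, (Real.exp (U ω) - 1) ∂μ :=
      integral_mono hUi1 (hUi.sub (integrable_const 1)) fun ω => by
        linarith [Real.add_one_le_exp (U ω)]
    rw [integral_sub hUi (integrable_const 1)] at this
    simp only [integral_const, probReal_univ, smul_eq_mul, mul_one] at this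
    linarith
  have hpq : Integrable (fun ω => p ω * q ω) μ := by
    refine (hUi1.const_mul K).mono' (hp.mul hq).aestronglyMeasurable (ae_of_all _ fun ω => ?_)
    rw [Real.norm_eq_abs, hU, mul_div_cancel₀ _ hK.ne']
  set M := ∫ ω', p ω' * q ω' ∂μ with hM
  have hMK : |M| / K ≤ 1 := by
    have : |M| ≤ ∫ ω, |p ω * q ω| ∂μ := abs_integral_le_integral_abs
    calc |M| / K ≤ (∫ ω, |p ω * q ω| ∂μ) / K := by gcongr
      _ = ∫ ω, U ω ∂μ := by rw [hU, integral_div]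
      _ ≤ 1 := hEU1
  set V : Ω → ℝ := fun ω => (p ω * q ω - M) / K with hV
  have hVi : Integrable V μ := (hpq.sub (integrable_const M)).div_const K
  have hV0 : ∫ ω, V ω ∂μ = 0 := by
    rw [hV, integral_div, integral_sub hpq (integrable_const M)]
    simp [hM]
  have hVU : ∀ ω, |V ω| ≤ U ω + 1 := by
    intro ω
    rw [hV, abs_div, abs_of_pos hK]
    calc |p ω * q ω - M| / K ≤ (|p ω * q ω| + |M|) / K := by gcongr; exact abs_sub _ _
      _ = U ω + |M| / K := by rw [add_div]
      _ ≤ _ := by gcongr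
  set s := t * K with hs
  have hs2 : |s| ≤ 1 / 2 := by rw [hs, abs_mul, abs_of_pos hK]; exact ht
  -- Second-order Taylor bound: the remainder is at most (sV)² e^|sV|. One factor e^(|V|/2) comes
  -- from |s| ≤ 1/2, another absorbs V², and |V| ≤ U + 1 turns their product into e · e^U, which is
  -- integrable.
  have hpt : ∀ ω, Real.exp (t * (p ω * q ω - M)) ≤
      1 + s * V ω + 8 * s ^ 2 * (Real.exp 1 * Real.exp (U ω)) := by
    intro ω
    have e : t * (p ω * q ω - M) = s * V ω := by simp only [hs, hV]; field_simp
    rw [e]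
    have h1 : Real.exp (s * V ω) - 1 - s * V ω ≤ (s * V ω) ^ 2 * Real.exp |s * V ω| := by
      have := Complex.norm_exp_sub_sum_le_norm_mul_exp ((s * V ω : ℝ) : ℂ) 2
      simp only [Finset.sum_range_succ, Finset.range_zero, Finset.sum_empty, pow_zero,
        Nat.factorial_zero, Nat.cast_one, div_one, zero_add, pow_one, Nat.factorial_one] at this
      rw [← Complex.ofReal_exp, ← Complex.ofReal_one, ← Complex.ofReal_add, ← Complex.ofReal_sub,
        Complex.norm_real, Complex.norm_real, Real.norm_eq_abs, Real.norm_eq_abs, sq_abs] at this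
      linarith [le_abs_self (Real.exp (s * V ω) - (1 + s * V ω))]
    have h2 : Real.exp |s * V ω| ≤ Real.exp (|V ω| / 2) := by
      rw [Real.exp_le_exp, abs_mul]
      nlinarith [abs_nonneg (V ω)]
    have h3 : V ω ^ 2 ≤ 8 * Real.exp (|V ω| / 2) := by
      have := Real.quadratic_le_exp_of_nonneg (x := |V ω| / 2) (by positivity)
      have h4 : |V ω| ^ 2 = V ω ^ 2 := sq_abs _
      have := abs_nonneg (V ω)
      nlinarith
    have h4 : Real.exp (|V ω| / 2) * Real.exp (|V ω| / 2) ≤ Real.exp 1 * Real.exp (U ω) := by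
      rw [← Real.exp_add, ← Real.exp_add, Real.exp_le_exp]
      linarith [hVU ω]
    have h5 : (s * V ω) ^ 2 * Real.exp |s * V ω| ≤
        8 * s ^ 2 * (Real.exp 1 * Real.exp (U ω)) := by
      calc (s * V ω) ^ 2 * Real.exp |s * V ω|
          ≤ s ^ 2 * (8 * Real.exp (|V ω| / 2)) * Real.exp (|V ω| / 2) := by
            rw [mul_pow]; gcongr
        _ = 8 * s ^ 2 * (Real.exp (|V ω| / 2) * Real.exp (|V ω| / 2)) := by ring
        _ ≤ _ := by gcongr
    linarith
  have hbd : Integrable (fun ω => 1 + s * V ω + 8 * s ^ 2 * (Real.exp 1 * Real.exp (U ω))) μ :=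
    ((integrable_const 1).add (hVi.const_mul s)).add ((hUi.const_mul _).const_mul _)
  have hXi : Integrable (fun ω => Real.exp (t * (p ω * q ω - M))) μ := by
    refine hbd.mono' (hexp (((hp.mul hq).sub_const M).const_mul t)).aestronglyMeasurable
      (ae_of_all _ fun ω => ?_)
    rw [Real.norm_eq_abs, abs_of_pos (Real.exp_pos _)]
    exact hpt ω
  refine lintegral_ofReal_le_of_integral_le hXi (fun _ => (Real.exp_pos _).le) ?_
  refine (integral_mono hXi hbd hpt).trans ?_
  have e3 : Integrable (fun ω => 1 + s * V ω) μ := (integrable_const 1).add (hVi.const_mul s)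
  rw [integral_add e3 ((hUi.const_mul _).const_mul _),
    integral_add (integrable_const 1) (hVi.const_mul s), integral_const_mul, integral_const_mul,
    integral_const_mul, hV0]
  simp only [integral_const, probReal_univ, smul_eq_mul, mul_one, mul_zero, add_zero]
  have h6 := Real.add_one_le_exp (50 * s ^ 2)
  -- The quadratic term is at most 8 · 3 · 2 = 48 times s², whence the constant 50.
  have h7 : Real.exp 1 * ∫ ω, Real.exp (U ω) ∂μ ≤ 3 * 2 := by
    have := Real.exp_one_lt_d9
    gcongr
    linarith
  nlinarith [sq_nonneg s]

end SparseLTI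

/-! ### Lagged products of independent noise -/

namespace SparseLTI

/-- Functions of disjoint blocks of an independent family are independent; here a block will be the
set of noise coordinates at the two times entering one lagged product. -/
lemma lintegral_prod_eq_prod_lintegral_of_iIndep {Ω κ τ : Type*} {mΩ : MeasurableSpace Ω}
    {μ : Measure Ω} {m : κ → MeasurableSpace Ω} (hm : ∀ k, m k ≤ mΩ) (h : iIndep m μ)
    (S : τ → Set κ) (F : τ → Ω → ENNReal) (s : Finset τ)
    (hS : (s : Set τ).PairwiseDisjoint S)
    (hF : ∀ t, Measurable[⨆ k ∈ S t, m k] (F t)) :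
    ∫⁻ ω, ∏ t ∈ s, F t ω ∂μ = ∏ t ∈ s, ∫⁻ ω, F t ω ∂μ := by
  classical
  have : IsProbabilityMeasure μ := h.isProbabilityMeasure
  induction s using Finset.cons_induction with
  | empty => simp
  | cons a s ha ih =>
    rw [Finset.prod_cons, ← ih (hS.subset (by simp))]
    simp_rw [Finset.prod_cons]
    have hd : Disjoint (S a) (⋃ t ∈ s, S t) := by
      rw [Set.disjoint_iUnion₂_right]
      intro t ht
      exact hS (by simp) (by simp [ht]) (by rintro rfl; exact ha ht)
    refine lintegral_mul_eq_lintegral_mul_lintegral_of_independent_measurableSpace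
      (iSup₂_le fun k _ => hm k) (iSup₂_le fun k _ => hm k)
      (indep_iSup_of_disjoint hm h hd) (hF a) ?_
    refine Finset.measurable_prod _ fun t ht => (hF t).mono ?_ le_rfl
    exact iSup₂_le fun k hk => le_iSup₂_of_le k (Set.mem_biUnion ht hk) le_rfl

variable {Ω ι : Type*} [MeasurableSpace Ω] [Fintype ι] {μ : Measure Ω}

/-- Independent uniformly sub-Gaussian noise with time-constant second moments `σ`. -/
structure IsSubgaussianNoise (μ : Measure Ω) (e : ℤ × ι → Ω → ℝ) (c : NNReal) (σ : ι → ℝ) :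
    Prop where
  c_pos : 0 < c
  measurable : ∀ i, Measurable (e i)
  indep : iIndepFun e μ
  subgaussian : ∀ i, HasSubgaussianMGF (e i) c μ
  integral_eq_zero : ∀ i, ∫ ω, e i ω ∂μ = 0
  integral_sq : ∀ i, ∫ ω, e i ω ^ 2 ∂μ = σ i.2

/-- A linear combination of the noise coordinates at time `s`. -/
def linForm (e : ℤ × ι → Ω → ℝ) (a : ι → ℝ) (s : ℤ) (ω : Ω) : ℝ := ∑ l, a l * e (s, l) ω

namespace IsSubgaussianNoise

variable {e : ℤ × ι → Ω → ℝ} {c : NNReal} {σ : ι → ℝ}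

omit [Fintype ι] in
lemma isProbabilityMeasure (h : IsSubgaussianNoise μ e c σ) : IsProbabilityMeasure μ :=
  h.indep.isProbabilityMeasure

lemma measurable_linForm (h : IsSubgaussianNoise μ e c σ) (a : ι → ℝ) (s : ℤ) :
    Measurable (linForm e a s) :=
  Finset.measurable_sum _ fun l _ => (h.measurable (s, l)).const_mul _

lemma hasSubgaussianMGF_linForm (h : IsSubgaussianNoise μ e c σ) (a : ι → ℝ) (s : ℤ)
    {d : NNReal} (hd : c * ∑ l, a l ^ 2 ≤ (d : ℝ)) :
    HasSubgaussianMGF (linForm e a s) d μ := by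
  have := h.isProbabilityMeasure
  have hi : iIndepFun (fun l ω => a l * e (s, l) ω) μ :=
    (h.indep.precomp (g := fun l : ι => (s, l)) (fun l l' hl => by simpa using hl)).comp
      (fun l x => a l * x) (fun l => measurable_id.const_mul _)
  have h1 := HasSubgaussianMGF.sum_of_iIndepFun hi (s := Finset.univ)
    fun l _ => (h.subgaussian (s, l)).const_mul (a l)
  refine ⟨h1.integrable_exp_mul, fun t => (h1.mgf_le t).trans (Real.exp_le_exp.2 ?_)⟩
  have h2 : (((∑ l, ⟨a l ^ 2, sq_nonneg _⟩ * c : NNReal)) : ℝ) = c * ∑ l, a l ^ 2 := by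
    push_cast
    rw [Finset.mul_sum]
    exact Finset.sum_congr rfl fun l _ => mul_comm _ _
  rw [h2]
  have := sq_nonneg t
  gcongr

lemma lintegral_exp_sq_linForm_le (h : IsSubgaussianNoise μ e c σ) {a : ι → ℝ}
    (ha : ∑ l, a l ^ 2 ≤ 1) (s : ℤ) :
    ∫⁻ ω, ENNReal.ofReal (Real.exp (linForm e a s ω ^ 2 / (4 * c))) ∂μ ≤ 2 := by
  have := h.isProbabilityMeasure
  refine HasSubgaussianMGF.lintegral_exp_sq_le (h.hasSubgaussianMGF_linForm a s ?_) h.c_pos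
  exact mul_le_of_le_one_right c.2 ha

omit [MeasurableSpace Ω] in
lemma measurable_linForm_iSup (a : ι → ℝ) (s : ℤ) (S : Set (ℤ × ι)) (hS : ∀ l, (s, l) ∈ S) :
    Measurable[⨆ k ∈ S, MeasurableSpace.comap (e k) inferInstance] (linForm e a s) := by
  refine Finset.measurable_sum _ fun l _ => Measurable.const_mul ?_ _
  exact Measurable.of_comap_le
    (le_iSup₂_of_le (f := fun k (_ : k ∈ S) => MeasurableSpace.comap (e k) inferInstance)
      (s, l) (hS l) le_rfl)

/-- Centred lagged products, summed over a set of times, when the involved times are disjoint. -/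
lemma lintegral_exp_sum_lagged_le_of_pairwise (h : IsSubgaussianNoise μ e c σ) {a b : ι → ℝ}
    (ha : ∑ l, a l ^ 2 ≤ 1) (hb : ∑ l, b l ^ 2 ≤ 1) (p q : ℕ) (s : Finset ℕ)
    (hs : ∀ t ∈ s, ∀ t' ∈ s, t ≠ t' → (t : ℤ) - p ≠ t' - q) {θ : ℝ}
    (hθ : |θ| * (4 * c) ≤ 1 / 2) :
    ∫⁻ ω, ENNReal.ofReal (Real.exp (θ * ∑ t ∈ s,
      (linForm e a (t - p) ω * linForm e b (t - q) ω -
        ∫ ω', linForm e a (t - p) ω' * linForm e b (t - q) ω' ∂μ))) ∂μ ≤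
      ENNReal.ofReal (Real.exp (s.card * (50 * (θ * (4 * c)) ^ 2))) := by
  have := h.isProbabilityMeasure
  have hc : (0 : ℝ) < 4 * c := mul_pos (by norm_num) h.c_pos
  simp_rw [Finset.mul_sum, Real.exp_sum]
  have e1 : ∀ ω, ENNReal.ofReal (∏ t ∈ s, Real.exp (θ *
      (linForm e a (t - p) ω * linForm e b (t - q) ω -
        ∫ ω', linForm e a (t - p) ω' * linForm e b (t - q) ω' ∂μ))) =
      ∏ t ∈ s, ENNReal.ofReal (Real.exp (θ *
      (linForm e a (t - p) ω * linForm e b (t - q) ω -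
        ∫ ω', linForm e a (t - p) ω' * linForm e b (t - q) ω' ∂μ))) := fun ω =>
    ENNReal.ofReal_prod_of_nonneg fun _ _ => (Real.exp_pos _).le
  simp_rw [e1]
  rw [lintegral_prod_eq_prod_lintegral_of_iIndep
    (m := fun k => MeasurableSpace.comap (e k) inferInstance)
    (fun k => (h.measurable k).comap_le) h.indep.iIndep
    (fun t : ℕ => {k : ℤ × ι | k.1 = (t : ℤ) - p ∨ k.1 = (t : ℤ) - q})]
  · rw [Real.exp_nat_mul, ENNReal.ofReal_pow (Real.exp_pos _).le]
    refine Finset.prod_le_pow_card _ _ _ fun t _ => ?_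
    exact lintegral_exp_mul_centered_mul_le (h.measurable_linForm a _).aemeasurable
      (h.measurable_linForm b _).aemeasurable hc (h.lintegral_exp_sq_linForm_le ha _)
      (h.lintegral_exp_sq_linForm_le hb _) hθ
  · intro t ht t' ht' hne
    rw [Function.onFun, Set.disjoint_left]
    rintro ⟨k, l⟩ h1 h2
    simp only [Set.mem_ofPred_eq] at h1 h2
    have h3 := hs t ht t' ht' hne
    have h4 := hs t' ht' t ht hne.symm
    omega
  · intro t
    have h1 := measurable_linForm_iSup (e := e) a ((t : ℤ) - p)
      {k : ℤ × ι | k.1 = (t : ℤ) - p ∨ k.1 = (t : ℤ) - q} (by simp)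
    have h2 := measurable_linForm_iSup (e := e) b ((t : ℤ) - q)
      {k : ℤ × ι | k.1 = (t : ℤ) - p ∨ k.1 = (t : ℤ) - q} (by simp)
    exact (Real.measurable_exp.comp (((h1.mul h2).sub_const _).const_mul θ)).ennreal_ofReal

/-- Summands at times t ≠ t' share noise only when |t - t'| = |p - q| = d. Colouring t by the parity
of ⌊t/d⌋ separates t from t + d, so each colour class has independent summands. Convexity of exp
joins the two classes at the price of doubling θ: the range shrinks from 1/2 to 1/4 and 50 becomes
200. -/
lemma lintegral_exp_sum_lagged_le (h : IsSubgaussianNoise μ e c σ) {a b : ι → ℝ}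
    (ha : ∑ l, a l ^ 2 ≤ 1) (hb : ∑ l, b l ^ 2 ≤ 1) (p q T : ℕ) {θ : ℝ}
    (hθ : |θ| * (4 * c) ≤ 1 / 4) :
    ∫⁻ ω, ENNReal.ofReal (Real.exp (θ * ∑ t ∈ Finset.range T,
      (linForm e a (t - p) ω * linForm e b (t - q) ω -
        ∫ ω', linForm e a (t - p) ω' * linForm e b (t - q) ω' ∂μ))) ∂μ ≤
      ENNReal.ofReal (Real.exp (T * (200 * (θ * (4 * c)) ^ 2))) := by
  set d := Int.natAbs ((p : ℤ) - q) with hd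
  have hdm : ∀ (P : ℕ → Prop) [DecidablePred P], (∀ t, P t → ¬ P (t + d) ∨ d = 0) →
      ∫⁻ ω, ENNReal.ofReal (Real.exp ((2 * θ) * ∑ t ∈ Finset.range T with P t,
      (linForm e a (t - p) ω * linForm e b (t - q) ω -
        ∫ ω', linForm e a (t - p) ω' * linForm e b (t - q) ω' ∂μ))) ∂μ ≤
      ENNReal.ofReal (Real.exp (T * (200 * (θ * (4 * c)) ^ 2))) := by
    intro P _ hP
    refine (h.lintegral_exp_sum_lagged_le_of_pairwise ha hb p q _ ?_ ?_).trans ?_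
    · intro t ht t' ht' hne heq
      simp only [Finset.mem_filter] at ht ht'
      have : t = t' + d ∨ t' = t + d := by omega
      rcases this with rfl | rfl
      · rcases hP t' ht'.2 with h1 | h1
        · exact h1 ht.2
        · omega
      · rcases hP t ht.2 with h1 | h1
        · exact h1 ht'.2
        · omega
    · rw [abs_mul, abs_two]; linarith
    · apply ENNReal.ofReal_le_ofReal
      rw [Real.exp_le_exp]
      have h1 : (((Finset.range T).filter P).card : ℝ) ≤ T := by
        exact_mod_cast (Finset.card_filter_le _ _).trans_eq (Finset.card_range T)
      have h2 : 50 * (2 * θ * (4 * c)) ^ 2 = 200 * (θ * (4 * c)) ^ 2 := by ring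
      rw [h2]
      gcongr
  have hpar : ∀ t, d ≠ 0 → (t + d) / d = t / d + 1 := fun t h0 =>
    Nat.add_div_right t (Nat.pos_of_ne_zero h0)
  -- For d = 0, division by zero gives t / d = 0, so all times fall in the even class; there no two
  -- distinct times conflict.
  have h1 := hdm (fun t => (t / d) % 2 = 0) (fun t ht => by
    rcases eq_or_ne d 0 with h0 | h0
    · exact Or.inr h0
    · left; rw [hpar t h0]; omega)
  have h2 := hdm (fun t => ¬ (t / d) % 2 = 0) (fun t ht => by
    rcases eq_or_ne d 0 with h0 | h0
    · exact Or.inr h0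
    · left; rw [hpar t h0]; omega)
  set D : ℕ → Ω → ℝ := fun t ω => linForm e a (t - p) ω * linForm e b (t - q) ω -
        ∫ ω', linForm e a (t - p) ω' * linForm e b (t - q) ω' ∂μ with hD
  have hDm : ∀ t, Measurable (D t) := fun t =>
    ((h.measurable_linForm a _).mul (h.measurable_linForm b _)).sub_const _
  set A : Ω → ℝ := fun ω => ∑ t ∈ Finset.range T with (t / d) % 2 = 0, D t ω
  set B : Ω → ℝ := fun ω => ∑ t ∈ Finset.range T with ¬ (t / d) % 2 = 0, D t ω
  have hAm : Measurable A := Finset.measurable_sum _ fun t _ => hDm t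
  have hpt : ∀ ω, ENNReal.ofReal (Real.exp (θ * ∑ t ∈ Finset.range T, D t ω)) ≤
      ENNReal.ofReal (1 / 2) * ENNReal.ofReal (Real.exp ((2 * θ) * A ω)) +
      ENNReal.ofReal (1 / 2) * ENNReal.ofReal (Real.exp ((2 * θ) * B ω)) := by
    intro ω
    rw [← ENNReal.ofReal_mul (by norm_num), ← ENNReal.ofReal_mul (by norm_num),
      ← ENNReal.ofReal_add (by positivity) (by positivity)]
    apply ENNReal.ofReal_le_ofReal
    have e1 : θ * ∑ t ∈ Finset.range T, D t ω =
        1 / 2 * ((2 * θ) * A ω) + 1 / 2 * ((2 * θ) * B ω) := by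
      rw [← Finset.sum_filter_add_sum_filter_not (Finset.range T) (fun t => (t / d) % 2 = 0)]
      ring
    rw [e1]
    exact convexOn_exp.2 (Set.mem_univ _) (Set.mem_univ _) (by norm_num) (by norm_num) (by norm_num)
  refine (lintegral_mono hpt).trans ?_
  rw [lintegral_add_left (by fun_prop), lintegral_const_mul' _ _ ENNReal.ofReal_ne_top,
    lintegral_const_mul' _ _ ENNReal.ofReal_ne_top]
  calc _ ≤ ENNReal.ofReal (1 / 2) * ENNReal.ofReal (Real.exp (T * (200 * (θ * (4 * c)) ^ 2))) +
        ENNReal.ofReal (1 / 2) * ENNReal.ofReal (Real.exp (T * (200 * (θ * (4 * c)) ^ 2))) := by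
        gcongr
    _ = _ := by
        rw [← add_mul, ← ENNReal.ofReal_add (by norm_num) (by norm_num)]
        norm_num

end IsSubgaussianNoise

end SparseLTI

/-! ### Exponential moments of weighted sums and of finite moving averages -/

namespace SparseLTI

section Exponential

variable {Ω : Type*} [MeasurableSpace Ω] {μ : Measure Ω}

/-- Jensen: the sum is a convex combination of the variables W · Y k, where W is the total weight.
The Y k may be arbitrarily dependent; only the total weight limits the admissible parameters. -/
lemma lintegral_exp_weighted_sum_le [IsProbabilityMeasure μ] {κ : Type*} (s : Finset κ)
    (w : κ → ℝ) (hw : ∀ k ∈ s, 0 ≤ w k) (Y : κ → Ω → ℝ) (hY : ∀ k, Measurable (Y k)) {V θ : ℝ}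
    (hV : ∑ k ∈ s, w k ≤ V) {B : ENNReal} (hB : 1 ≤ B)
    (h : ∀ k ∈ s, ∀ φ : ℝ, |φ| ≤ |θ| * V →
      ∫⁻ ω, ENNReal.ofReal (Real.exp (φ * Y k ω)) ∂μ ≤ B) :
    ∫⁻ ω, ENNReal.ofReal (Real.exp (θ * ∑ k ∈ s, w k * Y k ω)) ∂μ ≤ B := by
  set W := ∑ k ∈ s, w k with hW
  have hW0 : 0 ≤ W := Finset.sum_nonneg hw
  rcases hW0.eq_or_lt with h0 | h0
  · have h1 := (Finset.sum_eq_zero_iff_of_nonneg hw).1 (hW.symm.trans h0.symm)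
    have h2 : ∀ ω, ∑ k ∈ s, w k * Y k ω = 0 := fun ω =>
      Finset.sum_eq_zero fun k hk => by rw [h1 k hk, zero_mul]
    simpa [h2] using hB
  have hpt : ∀ ω, ENNReal.ofReal (Real.exp (θ * ∑ k ∈ s, w k * Y k ω)) ≤
      ∑ k ∈ s, ENNReal.ofReal (w k / W) * ENNReal.ofReal (Real.exp (θ * W * Y k ω)) := by
    intro ω
    have h1 : ∀ k ∈ s, 0 ≤ w k / W := fun k hk => div_nonneg (hw k hk) h0.le
    have h2 : ∑ k ∈ s, w k / W = 1 := by rw [← Finset.sum_div, ← hW, div_self h0.ne']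
    have := convexOn_exp.map_sum_le h1 h2 (p := fun k => θ * W * Y k ω)
      (fun _ _ => Set.mem_univ _)
    simp only [smul_eq_mul] at this
    have e : θ * ∑ k ∈ s, w k * Y k ω = ∑ k ∈ s, w k / W * (θ * W * Y k ω) := by
      rw [Finset.mul_sum]
      refine Finset.sum_congr rfl fun k _ => ?_
      field_simp
    rw [e]
    refine (ENNReal.ofReal_le_ofReal this).trans_eq ?_
    rw [ENNReal.ofReal_sum_of_nonneg fun k hk => mul_nonneg (h1 k hk) (Real.exp_pos _).le]
    exact Finset.sum_congr rfl fun k hk => ENNReal.ofReal_mul (h1 k hk)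
  refine (lintegral_mono hpt).trans ?_
  rw [lintegral_finsetSum]
  · calc _ ≤ ∑ k ∈ s, ENNReal.ofReal (w k / W) * B := by
          refine Finset.sum_le_sum fun k hk => ?_
          rw [lintegral_const_mul' _ _ ENNReal.ofReal_ne_top]
          gcongr
          refine h k hk _ ?_
          rw [abs_mul, abs_of_pos h0]
          gcongr
      _ = B := by
          rw [← Finset.sum_mul, ← ENNReal.ofReal_sum_of_nonneg
            fun k hk => div_nonneg (hw k hk) h0.le, ← Finset.sum_div, ← hW, div_self h0.ne']
          simp
  · intro k _
    have := hY k
    fun_prop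

lemma lintegral_exp_le_of_tendsto {Z : Ω → ℝ} {Zn : ℕ → Ω → ℝ} (hm : ∀ n, AEMeasurable (Zn n) μ)
    (hlim : ∀ᵐ ω ∂μ, Tendsto (fun n => Zn n ω) atTop (𝓝 (Z ω))) {B : ENNReal}
    (h : ∀ n, ∫⁻ ω, ENNReal.ofReal (Real.exp (Zn n ω)) ∂μ ≤ B) :
    ∫⁻ ω, ENNReal.ofReal (Real.exp (Z ω)) ∂μ ≤ B := by
  have h1 : ∀ᵐ ω ∂μ, ENNReal.ofReal (Real.exp (Z ω)) =
      liminf (fun n => ENNReal.ofReal (Real.exp (Zn n ω))) atTop := by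
    filter_upwards [hlim] with ω hω
    exact (ENNReal.tendsto_ofReal ((Real.continuous_exp.tendsto _).comp hω)).liminf_eq.symm
  rw [lintegral_congr_ae h1]
  refine (lintegral_liminf_le' fun n =>
    (Real.measurable_exp.comp_aemeasurable (hm n)).ennreal_ofReal).trans ?_
  exact (liminf_le_liminf (Eventually.of_forall h)).trans_eq (liminf_const B)

/-- A purely quadratic exponent excludes a mean: 1 + θ 𝔼Z ≤ exp(Aθ²) ≤ 1 + 2Aθ² for small θ, and
dividing by θ and letting it tend to 0 from either side gives 𝔼Z = 0. This identifies means of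
limits without interchanging limit and expectation. -/
lemma integrable_and_integral_eq_zero_of_exp_le [IsProbabilityMeasure μ] {Z : Ω → ℝ}
    (hZ : AEMeasurable Z μ) {θ₀ A : ℝ} (hθ₀ : 0 < θ₀) (hA : 0 ≤ A)
    (h : ∀ θ : ℝ, |θ| ≤ θ₀ →
      ∫⁻ ω, ENNReal.ofReal (Real.exp (θ * Z ω)) ∂μ ≤ ENNReal.ofReal (Real.exp (A * θ ^ 2))) :
    Integrable Z μ ∧ ∫ ω, Z ω ∂μ = 0 := by
  have hm : ∀ θ : ℝ, AEMeasurable (fun ω => Real.exp (θ * Z ω)) μ := fun θ =>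
    Real.measurable_exp.comp_aemeasurable (hZ.const_mul θ)
  have hint : ∀ θ : ℝ, |θ| ≤ θ₀ → Integrable (fun ω => Real.exp (θ * Z ω)) μ := fun θ hθ =>
    integrable_of_lintegral_ofReal_le (hm θ) (fun _ => (Real.exp_pos _).le)
      ENNReal.ofReal_ne_top (h θ hθ)
  have hle : ∀ θ : ℝ, |θ| ≤ θ₀ → ∫ ω, Real.exp (θ * Z ω) ∂μ ≤ Real.exp (A * θ ^ 2) := fun θ hθ =>
    integral_le_of_lintegral_ofReal_le (hm θ) (fun _ => (Real.exp_pos _).le) (Real.exp_pos _).le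
      (h θ hθ)
  have hZi : Integrable Z μ := by
    have h1 := hint θ₀ (abs_of_pos hθ₀).le
    have h2 := hint (-θ₀) (by rw [abs_neg, abs_of_pos hθ₀])
    refine ((h1.add h2).const_mul θ₀⁻¹).mono' hZ.aestronglyMeasurable (ae_of_all _ fun ω => ?_)
    rw [Real.norm_eq_abs, le_inv_mul_iff₀ hθ₀]
    have e1 := Real.add_one_le_exp (θ₀ * Z ω)
    have e2 := Real.add_one_le_exp (-θ₀ * Z ω)
    have e3 := Real.exp_pos (θ₀ * Z ω)
    have e4 := Real.exp_pos (-θ₀ * Z ω)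
    have e5 : θ₀ * |Z ω| = |θ₀ * Z ω| := by rw [abs_mul, abs_of_pos hθ₀]
    simp only [Pi.add_apply]
    rw [e5, abs_le]
    constructor <;> linarith
  refine ⟨hZi, ?_⟩
  have key : ∀ θ : ℝ, |θ| ≤ θ₀ → A * θ ^ 2 ≤ 1 → θ * ∫ ω, Z ω ∂μ ≤ 2 * A * θ ^ 2 := by
    intro θ hθ hθ1
    have h1 : ∫ ω, (θ * Z ω + 1) ∂μ ≤ ∫ ω, Real.exp (θ * Z ω) ∂μ :=
      integral_mono ((hZi.const_mul θ).add (integrable_const 1)) (hint θ hθ)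
        fun ω => Real.add_one_le_exp _
    rw [integral_add (hZi.const_mul θ) (integrable_const 1), integral_const_mul] at h1
    simp only [integral_const, probReal_univ, smul_eq_mul, mul_one] at h1
    have h0 : 0 ≤ A * θ ^ 2 := by positivity
    have h2 := (abs_le.1 (Real.abs_exp_sub_one_sub_id_le (x := A * θ ^ 2)
      (by rwa [abs_of_nonneg h0]))).2
    have h3 := hle θ hθ
    nlinarith
  have ev : ∀ᶠ θ : ℝ in 𝓝[>] 0, 0 < θ ∧ |θ| ≤ θ₀ ∧ A * θ ^ 2 ≤ 1 := by
    have c1 : ∀ᶠ θ : ℝ in 𝓝 0, |θ| < θ₀ :=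
      (continuous_abs.tendsto (0 : ℝ)).eventually_lt_const (by simpa using hθ₀)
    have c2 : ∀ᶠ θ : ℝ in 𝓝 0, A * θ ^ 2 < 1 :=
      ((by fun_prop : Continuous fun θ : ℝ => A * θ ^ 2).tendsto 0).eventually_lt_const (by simp)
    filter_upwards [self_mem_nhdsWithin, nhdsWithin_le_nhds c1, nhdsWithin_le_nhds c2]
      with θ e1 e2 e3
    exact ⟨e1, e2.le, e3.le⟩
  have lim : Tendsto (fun θ : ℝ => 2 * A * θ) (𝓝[>] 0) (𝓝 0) := by
    have : Tendsto (fun θ : ℝ => 2 * A * θ) (𝓝 0) (𝓝 (2 * A * 0)) :=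
      ((by fun_prop : Continuous fun θ : ℝ => 2 * A * θ).tendsto 0)
    rw [mul_zero] at this
    exact this.mono_left nhdsWithin_le_nhds
  apply le_antisymm
  · refine ge_of_tendsto lim ?_
    filter_upwards [ev] with θ ⟨e1, e2, e3⟩
    have := key θ e2 e3
    nlinarith
  · rw [← neg_nonpos]
    refine ge_of_tendsto lim ?_
    filter_upwards [ev] with θ ⟨e1, e2, e3⟩
    have := key (-θ) (by rwa [abs_neg]) (by rwa [neg_sq])
    rw [neg_sq] at this
    nlinarith

end Exponential

variable {Ω ι : Type*} [MeasurableSpace Ω] [Fintype ι] {μ : Measure Ω}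

/-- The partial sums of the moving average with coefficients `a` at time `t`. -/
def noiseSum (e : ℤ × ι → Ω → ℝ) (a : ℕ → ι → ℝ) (N t : ℕ) (ω : Ω) : ℝ :=
  ∑ τ ∈ Finset.range N, linForm e (a τ) ((t : ℤ) - τ) ω

/-- `X` is the moving average of the noise `e` with coefficients `a` of total Euclidean mass
at most `K`. -/
structure IsMovingAverage (μ : Measure Ω) (e : ℤ × ι → Ω → ℝ) (a : ℕ → ι → ℝ) (K : ℝ)
    (X : ℕ → Ω → ℝ) : Prop where
  pos : 0 < K
  sum_le : ∀ N, ∑ τ ∈ Finset.range N, √(∑ l, a τ l ^ 2) ≤ K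
  tendsto : ∀ᵐ ω ∂μ, ∀ t, Tendsto (fun N => noiseSum e a N t ω) atTop (𝓝 (X t ω))

/-- Covariance contributed by lag `τ` to two moving averages. -/
def lagCov (σ : ι → ℝ) (a b : ℕ → ι → ℝ) (τ : ℕ) : ℝ := ∑ l, a τ l * b τ l * σ l

lemma exists_normalized (v : ι → ℝ) :
    ∃ v' : ι → ℝ, ∑ l, v' l ^ 2 ≤ 1 ∧ ∀ l, v l = √(∑ l, v l ^ 2) * v' l := by
  set r := √(∑ l, v l ^ 2) with hr
  have hs : 0 ≤ ∑ l, v l ^ 2 := Finset.sum_nonneg fun _ _ => sq_nonneg _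
  have hr2 : r ^ 2 = ∑ l, v l ^ 2 := Real.sq_sqrt hs
  -- When r = 0 the quotient is the zero vector, which still satisfies both claims.
  refine ⟨fun l => v l / r, ?_, fun l => ?_⟩
  · simp_rw [div_pow]
    rw [← Finset.sum_div, hr2]
    exact div_self_le_one _
  · rcases eq_or_ne r 0 with h0 | h0
    · rw [h0, zero_mul]
      rw [h0] at hr2
      have := (Finset.sum_eq_zero_iff_of_nonneg fun l _ => sq_nonneg (v l)).1
        (hr2.symm.trans (by norm_num)) l (Finset.mem_univ l)
      exact pow_eq_zero_iff (two_ne_zero) |>.1 this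
    · field_simp

omit [MeasurableSpace Ω] in
lemma linForm_smul (e : ℤ × ι → Ω → ℝ) {a a' : ι → ℝ} {r : ℝ} (h : ∀ l, a l = r * a' l) (s : ℤ)
    (ω : Ω) : linForm e a s ω = r * linForm e a' s ω := by
  simp only [linForm, Finset.mul_sum]
  exact Finset.sum_congr rfl fun l _ => by rw [h l]; ring

namespace IsSubgaussianNoise

variable {e : ℤ × ι → Ω → ℝ} {c : NNReal} {σ : ι → ℝ}

omit [Fintype ι] in
lemma integral_mul (h : IsSubgaussianNoise μ e c σ) [DecidableEq ι] (i j : ℤ × ι) :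
    ∫ ω, e i ω * e j ω ∂μ = if i = j then σ i.2 else 0 := by
  split_ifs with hij
  · subst hij
    simp_rw [← sq]
    exact h.integral_sq i
  · rw [(h.indep.indepFun hij).integral_fun_mul_eq_mul_integral
      (h.measurable i).aestronglyMeasurable (h.measurable j).aestronglyMeasurable,
      h.integral_eq_zero i, zero_mul]

omit [Fintype ι] in
lemma integrable_mul (h : IsSubgaussianNoise μ e c σ) (i j : ℤ × ι) :
    Integrable (fun ω => e i ω * e j ω) μ := by
  have hm : ∀ i, MemLp (e i) 2 μ := fun i => by simpa using (h.subgaussian i).memLp 2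
  exact (hm i).integrable_mul (hm j)

lemma integral_linForm_mul (h : IsSubgaussianNoise μ e c σ) (a b : ι → ℝ) (s s' : ℤ) :
    ∫ ω, linForm e a s ω * linForm e b s' ω ∂μ =
      if s = s' then ∑ l, a l * b l * σ l else 0 := by
  classical
  have e1 : ∀ ω, linForm e a s ω * linForm e b s' ω =
      ∑ l, ∑ l', (a l * b l') * (e (s, l) ω * e (s', l') ω) := by
    intro ω
    rw [linForm, linForm, Finset.sum_mul_sum]
    exact Finset.sum_congr rfl fun l _ => Finset.sum_congr rfl fun l' _ => by ring
  simp_rw [e1]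
  rw [integral_finsetSum _ fun l _ => integrable_finsetSum _ fun l' _ =>
    (h.integrable_mul _ _).const_mul _]
  simp_rw [integral_finsetSum Finset.univ fun l' _ => (h.integrable_mul _ _).const_mul _,
    integral_const_mul, h.integral_mul]
  split_ifs with hs
  · subst hs
    refine Finset.sum_congr rfl fun l _ => ?_
    rw [Finset.sum_eq_single l (fun l' _ hl => by simp [Ne.symm hl]) (by simp)]
    simp
  · simp [hs]

omit [Fintype ι] in
lemma sigma_nonneg (h : IsSubgaussianNoise μ e c σ) (l : ι) : 0 ≤ σ l := by
  rw [← h.integral_sq (0, l)]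
  exact integral_nonneg fun _ => sq_nonneg _

omit [Fintype ι] in
-- Taking expectations in y ≤ e^y - 1 with y = e²/(4c), where the exponential has mean at most 2.
lemma sigma_le (h : IsSubgaussianNoise μ e c σ) (l : ι) : σ l ≤ 4 * c := by
  have := h.isProbabilityMeasure
  have hc : (0 : ℝ) < 4 * c := mul_pos (by norm_num) h.c_pos
  have h1 := HasSubgaussianMGF.lintegral_exp_sq_le (h.subgaussian (0, l)) h.c_pos
  have hm : AEMeasurable (fun ω => Real.exp (e (0, l) ω ^ 2 / (4 * c))) μ := by
    have := h.measurable (0, l)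
    fun_prop
  have h2 := integrable_of_lintegral_ofReal_le hm (fun _ => (Real.exp_pos _).le) (by simp) h1
  have h3 := integral_le_of_lintegral_ofReal_le hm (fun _ => (Real.exp_pos _).le)
    (by norm_num) (b := 2) (by simpa using h1)
  have h4 : Integrable (fun ω => e (0, l) ω ^ 2) μ := by
    simpa [sq] using h.integrable_mul (0, l) (0, l)
  rw [← h.integral_sq (0, l)]
  have h5 : ∫ ω, e (0, l) ω ^ 2 ∂μ ≤
      ∫ ω, 4 * c * (Real.exp (e (0, l) ω ^ 2 / (4 * c)) - 1) ∂μ := by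
    refine integral_mono h4 ((h2.sub (integrable_const 1)).const_mul _) fun ω => ?_
    have := Real.add_one_le_exp (e (0, l) ω ^ 2 / (4 * c))
    calc e (0, l) ω ^ 2 = 4 * c * (e (0, l) ω ^ 2 / (4 * c)) := (mul_div_cancel₀ _ hc.ne').symm
      _ ≤ _ := by gcongr; linarith
  rw [integral_const_mul, integral_sub h2 (integrable_const 1)] at h5
  simp only [integral_const, probReal_univ, smul_eq_mul, mul_one] at h5
  nlinarith

lemma abs_lagCov_le (h : IsSubgaussianNoise μ e c σ) (a b : ℕ → ι → ℝ) (τ : ℕ) :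
    |lagCov σ a b τ| ≤ 4 * c * (√(∑ l, a τ l ^ 2) * √(∑ l, b τ l ^ 2)) := by
  calc |lagCov σ a b τ| ≤ ∑ l, |a τ l * b τ l * σ l| := Finset.abs_sum_le_sum_abs _ _
    _ ≤ ∑ l, 4 * c * (|a τ l| * |b τ l|) := by
        refine Finset.sum_le_sum fun l _ => ?_
        rw [abs_mul, abs_mul, abs_of_nonneg (h.sigma_nonneg l), mul_comm]
        gcongr
        exact h.sigma_le l
    _ = 4 * c * ∑ l, |a τ l| * |b τ l| := by rw [Finset.mul_sum]
    _ ≤ _ := by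
        gcongr
        have := Real.sum_mul_le_sqrt_mul_sqrt Finset.univ (fun l => |a τ l|) (fun l => |b τ l|)
        simpa only [sq_abs] using this

lemma sum_abs_lagCov_le (h : IsSubgaussianNoise μ e c σ) {a b : ℕ → ι → ℝ} {Ka Kb : ℝ}
    (ha : ∀ N, ∑ τ ∈ Finset.range N, √(∑ l, a τ l ^ 2) ≤ Ka)
    (hb : ∀ N, ∑ τ ∈ Finset.range N, √(∑ l, b τ l ^ 2) ≤ Kb) (N : ℕ) :
    ∑ τ ∈ Finset.range N, |lagCov σ a b τ| ≤ 4 * c * Ka * Kb := by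
  have hKa : 0 ≤ Ka := by simpa using ha 0
  calc ∑ τ ∈ Finset.range N, |lagCov σ a b τ|
      ≤ ∑ τ ∈ Finset.range N, 4 * c * (Ka * √(∑ l, b τ l ^ 2)) := by
        refine Finset.sum_le_sum fun τ hτ => (h.abs_lagCov_le a b τ).trans ?_
        have : √(∑ l, a τ l ^ 2) ≤ Ka :=
          (Finset.single_le_sum (f := fun τ => √(∑ l, a τ l ^ 2))
            (fun _ _ => Real.sqrt_nonneg _) hτ).trans (ha N)
        gcongr
    _ = 4 * c * Ka * ∑ τ ∈ Finset.range N, √(∑ l, b τ l ^ 2) := by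
        rw [Finset.mul_sum]
        exact Finset.sum_congr rfl fun τ _ => by ring
    _ ≤ _ := by gcongr; exact hb N

lemma lintegral_exp_noiseSum_le (h : IsSubgaussianNoise μ e c σ) {a : ℕ → ι → ℝ} {Ka : ℝ}
    (ha : ∀ N, ∑ τ ∈ Finset.range N, √(∑ l, a τ l ^ 2) ≤ Ka) (N t : ℕ) (θ : ℝ) :
    ∫⁻ ω, ENNReal.ofReal (Real.exp (θ * noiseSum e a N t ω)) ∂μ ≤
      ENNReal.ofReal (Real.exp (c * Ka ^ 2 / 2 * θ ^ 2)) := by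
  have := h.isProbabilityMeasure
  have hKa : 0 ≤ Ka := by simpa using ha 0
  choose a' ha' haa' using fun τ => exists_normalized (a τ)
  have e1 : ∀ ω, noiseSum e a N t ω =
      ∑ τ ∈ Finset.range N, √(∑ l, a τ l ^ 2) * linForm e (a' τ) (t - τ) ω := fun ω =>
    Finset.sum_congr rfl fun τ _ => linForm_smul e (haa' τ) _ ω
  simp_rw [e1]
  refine lintegral_exp_weighted_sum_le _ _ (fun _ _ => Real.sqrt_nonneg _)
    (fun τ => linForm e (a' τ) (t - τ)) (fun τ => h.measurable_linForm _ _) (ha N) ?_ ?_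
  · rw [ENNReal.one_le_ofReal, Real.one_le_exp_iff]
    positivity
  · intro τ _ φ hφ
    have hs := h.hasSubgaussianMGF_linForm (a' τ) (t - τ) (d := c)
      (mul_le_of_le_one_right c.2 (ha' τ))
    refine lintegral_ofReal_le_of_integral_le (hs.integrable_exp_mul φ)
      (fun _ => (Real.exp_pos _).le) ((hs.mgf_le φ).trans (Real.exp_le_exp.2 ?_))
    have h1 : φ ^ 2 ≤ (|θ| * Ka) ^ 2 := by rw [← sq_abs φ]; gcongr
    rw [mul_pow, sq_abs] at h1
    calc c * φ ^ 2 / 2 ≤ c * (θ ^ 2 * Ka ^ 2) / 2 := by gcongr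
      _ = _ := by ring

/-- The product expands over pairs of lags with weights ‖a_p‖‖b_q‖ of total mass at most Ka · Kb.
Each pair contributes a sum over t of centred lagged products of normalized forms, and Jensen
combines the pairs. Only equal lags contribute to the mean, because the noise is independent across
time. -/
lemma lintegral_exp_sum_noiseSum_mul_le (h : IsSubgaussianNoise μ e c σ) {a b : ℕ → ι → ℝ}
    {Ka Kb : ℝ} (ha : ∀ N, ∑ τ ∈ Finset.range N, √(∑ l, a τ l ^ 2) ≤ Ka)
    (hb : ∀ N, ∑ τ ∈ Finset.range N, √(∑ l, b τ l ^ 2) ≤ Kb) (N T : ℕ) {θ : ℝ}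
    (hθ : |θ| * (4 * c * Ka * Kb) ≤ 1 / 4) :
    ∫⁻ ω, ENNReal.ofReal (Real.exp (θ * ∑ t ∈ Finset.range T,
      (noiseSum e a N t ω * noiseSum e b N t ω - ∑ τ ∈ Finset.range N, lagCov σ a b τ))) ∂μ ≤
      ENNReal.ofReal (Real.exp (200 * T * (4 * c * Ka * Kb) ^ 2 * θ ^ 2)) := by
  have := h.isProbabilityMeasure
  have hKa : 0 ≤ Ka := by simpa using ha 0
  have hKb : 0 ≤ Kb := by simpa using hb 0
  choose a' ha' haa' using fun τ => exists_normalized (a τ)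
  choose b' hb' hbb' using fun τ => exists_normalized (b τ)
  set w : ℕ × ℕ → ℝ := fun x => √(∑ l, a x.1 l ^ 2) * √(∑ l, b x.2 l ^ 2) with hw
  set Y : ℕ × ℕ → Ω → ℝ := fun x ω => ∑ t ∈ Finset.range T,
      (linForm e (a' x.1) (t - x.1) ω * linForm e (b' x.2) (t - x.2) ω -
        ∫ ω', linForm e (a' x.1) (t - x.1) ω' * linForm e (b' x.2) (t - x.2) ω' ∂μ) with hY
  have e1 : ∀ ω, ∑ t ∈ Finset.range T, (noiseSum e a N t ω * noiseSum e b N t ω -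
      ∑ τ ∈ Finset.range N, lagCov σ a b τ) =
      ∑ x ∈ Finset.range N ×ˢ Finset.range N, w x * Y x ω := by
    intro ω
    simp_rw [hY, Finset.mul_sum]
    rw [Finset.sum_comm]
    refine Finset.sum_congr rfl fun t _ => ?_
    have e2 : ∑ τ ∈ Finset.range N, lagCov σ a b τ =
        ∑ x ∈ Finset.range N ×ˢ Finset.range N,
          ∫ ω', linForm e (a x.1) (t - x.1) ω' * linForm e (b x.2) (t - x.2) ω' ∂μ := by
      simp_rw [h.integral_linForm_mul]
      rw [Finset.sum_product]
      refine Finset.sum_congr rfl fun τ hτ => ?_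
      rw [Finset.sum_eq_single τ]
      · simp [lagCov]
      · intro τ' _ hne
        rw [if_neg]
        simp only
        omega
      · exact fun hn => absurd hτ hn
    rw [noiseSum, noiseSum, Finset.sum_mul_sum, ← Finset.sum_product', e2,
      ← Finset.sum_sub_distrib]
    refine Finset.sum_congr rfl fun x _ => ?_
    simp_rw [linForm_smul e (haa' x.1), linForm_smul e (hbb' x.2)]
    have e3 : ∀ ω', √(∑ l, a x.1 l ^ 2) * linForm e (a' x.1) (t - x.1) ω' *
        (√(∑ l, b x.2 l ^ 2) * linForm e (b' x.2) (t - x.2) ω') =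
        w x * (linForm e (a' x.1) (t - x.1) ω' * linForm e (b' x.2) (t - x.2) ω') := by
      intro ω'
      simp only [hw]
      ring
    simp_rw [e3, integral_const_mul]
    ring
  simp_rw [e1]
  refine lintegral_exp_weighted_sum_le _ w
    (fun _ _ => mul_nonneg (Real.sqrt_nonneg _) (Real.sqrt_nonneg _)) Y ?_ (V := Ka * Kb) ?_ ?_ ?_
  · intro x
    exact Finset.measurable_sum _ fun t _ =>
      ((h.measurable_linForm _ _).mul (h.measurable_linForm _ _)).sub_const _
  · rw [Finset.sum_product]
    simp only [hw]
    rw [← Finset.sum_mul_sum]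
    exact mul_le_mul (ha N) (hb N) (Finset.sum_nonneg fun _ _ => Real.sqrt_nonneg _) hKa
  · rw [ENNReal.one_le_ofReal, Real.one_le_exp_iff]
    positivity
  · intro x _ φ hφ
    refine (h.lintegral_exp_sum_lagged_le (ha' _) (hb' _) x.1 x.2 T ?_).trans ?_
    · calc |φ| * (4 * c) ≤ |θ| * (Ka * Kb) * (4 * c) := by gcongr
        _ = |θ| * (4 * c * Ka * Kb) := by ring
        _ ≤ _ := hθ
    · apply ENNReal.ofReal_le_ofReal
      rw [Real.exp_le_exp]
      have h1 : φ ^ 2 ≤ (|θ| * (Ka * Kb)) ^ 2 := by rw [← sq_abs φ]; gcongr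
      rw [mul_pow, sq_abs] at h1
      calc T * (200 * (φ * (4 * c)) ^ 2) = T * 200 * (4 * c) ^ 2 * φ ^ 2 := by ring
        _ ≤ T * 200 * (4 * c) ^ 2 * (θ ^ 2 * (Ka * Kb) ^ 2) := by gcongr
        _ = _ := by ring

end IsSubgaussianNoise

end SparseLTI

/-! ### Infinite moving averages: covariances and concentration -/

namespace SparseLTI

variable {Ω ι : Type*} [MeasurableSpace Ω] [Fintype ι] {μ : Measure Ω}
  {e : ℤ × ι → Ω → ℝ} {c : NNReal} {σ : ι → ℝ}

lemma IsSubgaussianNoise.measurable_noiseSum (h : IsSubgaussianNoise μ e c σ) (a : ℕ → ι → ℝ)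
    (N t : ℕ) : Measurable (noiseSum e a N t) :=
  Finset.measurable_sum _ fun _ _ => h.measurable_linForm _ _

namespace IsMovingAverage

variable {a b : ℕ → ι → ℝ} {Ka Kb : ℝ} {X Y : ℕ → Ω → ℝ}

lemma aemeasurable (hX : IsMovingAverage μ e a Ka X) (h : IsSubgaussianNoise μ e c σ) (t : ℕ) :
    AEMeasurable (X t) μ :=
  aemeasurable_of_tendsto_metrizable_ae atTop
    (fun N => (h.measurable_noiseSum a N t).aemeasurable)
    (by filter_upwards [hX.tendsto] with ω hω using hω t)

lemma summable_lagCov (hX : IsMovingAverage μ e a Ka X) (hY : IsMovingAverage μ e b Kb Y)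
    (h : IsSubgaussianNoise μ e c σ) : Summable (lagCov σ a b) :=
  (summable_of_sum_range_le (fun _ => abs_nonneg _)
    (h.sum_abs_lagCov_le hX.sum_le hY.sum_le)).of_abs

lemma abs_tsum_lagCov_le (hX : IsMovingAverage μ e a Ka X) (hY : IsMovingAverage μ e b Kb Y)
    (h : IsSubgaussianNoise μ e c σ) : |∑' τ, lagCov σ a b τ| ≤ 4 * c * Ka * Kb := by
  refine le_of_tendsto (hX.summable_lagCov hY h).hasSum.tendsto_sum_nat.abs
    (Eventually.of_forall fun N => ?_)
  exact (Finset.abs_sum_le_sum_abs _ _).trans (h.sum_abs_lagCov_le hX.sum_le hY.sum_le N)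

lemma lintegral_exp_sum_mul_le (hX : IsMovingAverage μ e a Ka X)
    (hY : IsMovingAverage μ e b Kb Y) (h : IsSubgaussianNoise μ e c σ) (T : ℕ) {θ : ℝ}
    (hθ : |θ| * (4 * c * Ka * Kb) ≤ 1 / 4) :
    ∫⁻ ω, ENNReal.ofReal (Real.exp (θ * ∑ t ∈ Finset.range T,
      (X t ω * Y t ω - ∑' τ, lagCov σ a b τ))) ∂μ ≤
      ENNReal.ofReal (Real.exp (200 * T * (4 * c * Ka * Kb) ^ 2 * θ ^ 2)) := by
  refine lintegral_exp_le_of_tendsto (fun N => Measurable.aemeasurable ?_) ?_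
    (fun N => h.lintegral_exp_sum_noiseSum_mul_le hX.sum_le hY.sum_le N T hθ)
  · exact (Finset.measurable_sum _ fun t _ => ((h.measurable_noiseSum a N t).mul
      (h.measurable_noiseSum b N t)).sub_const _).const_mul θ
  · filter_upwards [hX.tendsto, hY.tendsto] with ω h1 h2
    exact (tendsto_finsetSum _ fun t _ => ((h1 t).mul (h2 t)).sub
      (hX.summable_lagCov hY h).hasSum.tendsto_sum_nat).const_mul θ

/-- The exponential bound for T = 1, centred at the series of lag covariances, forces that series to
be the mean. -/
lemma integral_mul (hX : IsMovingAverage μ e a Ka X)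
    (hY : IsMovingAverage μ e b Kb Y) (h : IsSubgaussianNoise μ e c σ) :
    Integrable (fun ω => X 0 ω * Y 0 ω) μ ∧
      ∫ ω, X 0 ω * Y 0 ω ∂μ = ∑' τ, lagCov σ a b τ := by
  have := h.isProbabilityMeasure
  have hL : 0 < 4 * c * Ka * Kb :=
    mul_pos (mul_pos (mul_pos (by norm_num) h.c_pos) hX.pos) hY.pos
  set M := ∑' τ, lagCov σ a b τ with hM
  have hm : AEMeasurable (fun ω => X 0 ω * Y 0 ω - M) μ :=
    ((hX.aemeasurable h 0).mul (hY.aemeasurable h 0)).sub_const M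
  have key := integrable_and_integral_eq_zero_of_exp_le hm
    (θ₀ := 1 / 4 / (4 * c * Ka * Kb)) (A := 200 * (4 * c * Ka * Kb) ^ 2)
    (by positivity) (by positivity) (fun θ hθ => by
      have := hX.lintegral_exp_sum_mul_le hY h 1 (θ := θ) ((le_div_iff₀ hL).1 hθ)
      simpa using this)
  have hi : Integrable (fun ω => X 0 ω * Y 0 ω) μ := by
    have := key.1.add (integrable_const M)
    simpa [Pi.add_def] using this
  refine ⟨hi, ?_⟩
  have h2 := key.2
  rw [integral_sub hi (integrable_const M)] at h2
  simp only [integral_const, probReal_univ, smul_eq_mul, one_mul] at h2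
  linarith

lemma integral_eq_zero (hX : IsMovingAverage μ e a Ka X) (h : IsSubgaussianNoise μ e c σ)
    (t : ℕ) : ∫ ω, X t ω ∂μ = 0 := by
  have := h.isProbabilityMeasure
  refine (integrable_and_integral_eq_zero_of_exp_le (hX.aemeasurable h t) one_pos
    (A := c * Ka ^ 2 / 2) (by positivity) fun θ _ => ?_).2
  refine lintegral_exp_le_of_tendsto
    (fun N => ((h.measurable_noiseSum a N t).const_mul θ).aemeasurable) ?_
    (fun N => h.lintegral_exp_noiseSum_le hX.sum_le N t θ)
  filter_upwards [hX.tendsto] with ω h1 using (h1 t).const_mul θ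

lemma memLp_two (hX : IsMovingAverage μ e a Ka X) (h : IsSubgaussianNoise μ e c σ) :
    MemLp (X 0) 2 μ := by
  rw [memLp_two_iff_integrable_sq (hX.aemeasurable h 0).aestronglyMeasurable]
  simpa [sq] using (hX.integral_mul hX h).1

lemma covariance_eq (hX : IsMovingAverage μ e a Ka X) (hY : IsMovingAverage μ e b Kb Y)
    (h : IsSubgaussianNoise μ e c σ) :
    covariance (X 0) (Y 0) μ = ∑' τ, lagCov σ a b τ := by
  have := h.isProbabilityMeasure
  rw [covariance_eq_sub (hX.memLp_two h) (hY.memLp_two h), hX.integral_eq_zero h, zero_mul,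
    sub_zero, ← (hX.integral_mul hY h).2]
  rfl

/-- Concentration of the empirical second moments of two moving averages. -/
lemma measure_abs_sum_mul_ge_le (hX : IsMovingAverage μ e a Ka X)
    (hY : IsMovingAverage μ e b Kb Y) (h : IsSubgaussianNoise μ e c σ) (T : ℕ) {r : ℝ}
    (hr0 : 0 ≤ r) (hr1 : r ≤ 1) :
    μ {ω | T * (66 * (4 * c * Ka * Kb) * r) ≤
      |∑ t ∈ Finset.range T, (X t ω * Y t ω - ∑' τ, lagCov σ a b τ)|} ≤
      ENNReal.ofReal (2 * Real.exp (-(4 * (T * r ^ 2)))) := by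
  set L := 4 * c * Ka * Kb with hLdef
  have hL : 0 < L := mul_pos (mul_pos (mul_pos (by norm_num) h.c_pos) hX.pos) hY.pos
  set S : Ω → ℝ := fun ω => ∑ t ∈ Finset.range T, (X t ω * Y t ω - ∑' τ, lagCov σ a b τ) with hS
  have hSm : AEMeasurable S μ := Finset.aemeasurable_fun_sum _ fun t _ =>
    ((hX.aemeasurable h t).mul (hY.aemeasurable h t)).sub_const _
  -- Chernoff with |θ| = r/(4L), admissible because r ≤ 1. The exponent is (200/16 - 66/4) T r² = -4
  -- T r²; the factor 4 will leave room for the union bound.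
  have tail : ∀ θ : ℝ, |θ| = r / (4 * L) →
      μ {ω | T * (66 * L * r) * (r / (4 * L)) ≤ θ * S ω} ≤
        ENNReal.ofReal (Real.exp (-(4 * (T * r ^ 2)))) := by
    intro θ hθ
    have hθ1 : |θ| * L ≤ 1 / 4 := by
      rw [hθ, div_mul_eq_mul_div, div_le_div_iff₀ (by positivity) (by norm_num)]
      nlinarith
    have hm : AEMeasurable (fun ω => ENNReal.ofReal (Real.exp (θ * S ω))) μ :=
      (Real.measurable_exp.comp_aemeasurable (hSm.const_mul θ)).ennreal_ofReal
    set y := T * (66 * L * r) * (r / (4 * L)) with hy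
    have h1 : {ω | y ≤ θ * S ω} ⊆
        {ω | ENNReal.ofReal (Real.exp y) ≤ ENNReal.ofReal (Real.exp (θ * S ω))} := fun ω hω =>
      ENNReal.ofReal_le_ofReal (Real.exp_le_exp.2 hω)
    refine (measure_mono h1).trans ((meas_ge_le_lintegral_div hm ?_ ENNReal.ofReal_ne_top).trans ?_)
    · simpa using Real.exp_pos y
    refine (ENNReal.div_le_div_right (hX.lintegral_exp_sum_mul_le hY h T hθ1) _).trans ?_
    rw [← ENNReal.ofReal_div_of_pos (Real.exp_pos _), ← Real.exp_sub]
    apply ENNReal.ofReal_le_ofReal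
    rw [Real.exp_le_exp, ← sq_abs θ, hθ, hy]
    have e1 : 200 * T * L ^ 2 * (r / (4 * L)) ^ 2 = 12.5 * (T * r ^ 2) := by
      field_simp
      ring
    have e2 : T * (66 * L * r) * (r / (4 * L)) = 16.5 * (T * r ^ 2) := by
      field_simp
      ring
    rw [e1, e2]
    linarith
  have hsub : {ω | T * (66 * L * r) ≤ |S ω|} ⊆
      {ω | T * (66 * L * r) * (r / (4 * L)) ≤ (r / (4 * L)) * S ω} ∪
      {ω | T * (66 * L * r) * (r / (4 * L)) ≤ (-(r / (4 * L))) * S ω} := by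
    intro ω hω
    have h0 : 0 ≤ r / (4 * L) := by positivity
    rcases le_abs.1 (show T * (66 * L * r) ≤ |S ω| from hω) with h1 | h1
    · left
      simp only [Set.mem_ofPred_eq]
      nlinarith
    · right
      simp only [Set.mem_ofPred_eq]
      nlinarith
  refine (measure_mono hsub).trans ((measure_union_le _ _).trans ?_)
  have h0 : 0 ≤ r / (4 * L) := by positivity
  refine (add_le_add (tail _ (abs_of_nonneg h0))
    (tail _ (by rw [abs_neg, abs_of_nonneg h0]))).trans_eq ?_
  rw [← ENNReal.ofReal_add (Real.exp_pos _).le (Real.exp_pos _).le]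
  congr 1
  ring

end IsMovingAverage

end SparseLTI

namespace SparseLTI

/-! ### Perturbation of the restricted linear system -/

section Perturbation

lemma norm_mulVec_le_infOpNorm {α β : Type*} [Fintype α] [Fintype β] (M : Matrix α β ℝ)
    (v : β → ℝ) : ‖M.mulVec v‖ ≤ infOpNorm M * ‖v‖ :=
  Matrix.linfty_opNorm_mulVec M v

lemma abs_sum_mul_le_of_entry_le {α : Type*} [Fintype α] {f : α → ℝ} {ε : ℝ}
    (hf : ∀ l, |f l| ≤ ε) (y : α → ℝ) :
    |∑ l, f l * y l| ≤ Fintype.card α * ε * ‖y‖ := by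
  refine (Finset.abs_sum_le_sum_abs _ _).trans ?_
  calc ∑ l, |f l * y l| ≤ ∑ _l : α, ε * ‖y‖ := by
        refine Finset.sum_le_sum fun l _ => ?_
        rw [abs_mul]
        exact mul_le_mul (hf l) (norm_le_pi_norm y l) (abs_nonneg _) ((abs_nonneg _).trans (hf l))
    _ = _ := by rw [Finset.sum_const, Finset.card_univ, nsmul_eq_mul]; ring

/-- Stability of a linear system with incoherence under an entrywise perturbation. -/
lemma exists_solution_of_entrywise_close {ι : Type*} [Fintype ι] [DecidableEq ι]
    {M Mh : Matrix ι ι ℝ} {S : Finset ι} {D ε γ : ℝ}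
    (hM : IsUnit (principalSub M S)) (hD : infOpNorm (principalSub M S)⁻¹ ≤ D)
    (hinc : ∀ i ∉ S, ∑ l, |Matrix.vecMul (fun a : S => M i a) (principalSub M S)⁻¹ l| ≤ 1 - γ)
    (hε : ∀ i j, |Mh i j - M i j| ≤ ε) (hγ0 : 0 < γ) (hγ : γ < 1) (hD0 : 0 ≤ D)
    (hsmall : D * S.card * ε ≤ γ / 8) :
    (∀ y : S → ℝ, (principalSub Mh S).mulVec y = 0 → y = 0) ∧
    ∀ (b : S → ℝ) (β : ℝ), (∀ i, |b i| ≤ β) → 0 ≤ β → ∃ y : S → ℝ,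
      (principalSub Mh S).mulVec y = b ∧ (∀ i, |y i| ≤ 2 * D * β) ∧
      ∀ i ∉ S, |∑ l : S, Mh i l * y l| ≤ (1 - γ / 2) * β := by
  set P := principalSub M S with hP
  set Q := principalSub Mh S with hQ
  have hdet : IsUnit P.det := (Matrix.isUnit_iff_isUnit_det P).1 hM
  have hcard : Fintype.card S = S.card := Fintype.card_coe S
  have hE : ∀ y : S → ℝ, ‖(Q - P).mulVec y‖ ≤ S.card * ε * ‖y‖ := by
    intro y
    -- With an empty index set nothing forces ε to be nonnegative, so this case is separated.
    rcases isEmpty_or_nonempty S with hemp | ⟨⟨i0⟩⟩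
    · have : y = 0 := Subsingleton.elim _ _
      simp [this]
    have hε0 : 0 ≤ ε := (abs_nonneg _).trans (hε i0 i0)
    refine (pi_norm_le_iff_of_nonneg (by positivity)).2 fun i => ?_
    rw [← hcard]
    exact abs_sum_mul_le_of_entry_le (f := fun l : S => Mh i l - M i l) (fun l => hε _ _) y
  -- Writing Q as a perturbation of P bounds ‖y‖ by D‖Qy‖ plus at most (γ/8)‖y‖, and the last term
  -- is absorbed on the left. This yields both injectivity and the factor 2D.
  have hinv : ∀ y : S → ℝ, y = P⁻¹.mulVec (Q.mulVec y - (Q - P).mulVec y) := by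
    intro y
    rw [Matrix.sub_mulVec, sub_sub_cancel, Matrix.mulVec_mulVec, Matrix.nonsing_inv_mul _ hdet,
      Matrix.one_mulVec]
  have hsub : ∀ y : S → ℝ, ‖Q.mulVec y - (Q - P).mulVec y‖ ≤
      ‖Q.mulVec y‖ + S.card * ε * ‖y‖ := fun y =>
    (norm_sub_le _ _).trans (add_le_add_right (hE y) _)
  have hbound : ∀ y : S → ℝ, ‖y‖ ≤ 2 * D * ‖Q.mulVec y‖ := by
    intro y
    have h1 : ‖y‖ ≤ D * (‖Q.mulVec y‖ + S.card * ε * ‖y‖) := by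
      conv_lhs => rw [hinv y]
      refine (norm_mulVec_le_infOpNorm _ _).trans ?_
      exact mul_le_mul hD (hsub y) (norm_nonneg _) hD0
    have h2 : D * S.card * ε * ‖y‖ ≤ γ / 8 * ‖y‖ := by gcongr
    nlinarith [norm_nonneg y]
  have hinj : ∀ y : S → ℝ, Q.mulVec y = 0 → y = 0 := by
    intro y hy
    have := hbound y
    rw [hy, norm_zero, mul_zero] at this
    exact norm_le_zero_iff.1 this
  refine ⟨hinj, fun b β hb hβ => ?_⟩
  have hsurj : Function.Surjective Q.mulVecLin := by
    rw [← LinearMap.injective_iff_surjective]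
    rw [← LinearMap.ker_eq_bot, LinearMap.ker_eq_bot']
    exact fun y hy => hinj y hy
  obtain ⟨y, hy⟩ := hsurj b
  rw [Matrix.mulVecLin_apply] at hy
  have hbn : ‖b‖ ≤ β := (pi_norm_le_iff_of_nonneg hβ).2 hb
  have hyn : ‖y‖ ≤ 2 * D * β := by
    refine (hbound y).trans ?_
    rw [hy]
    gcongr
  refine ⟨y, hy, fun i => (norm_le_pi_norm y i).trans hyn, fun i hi => ?_⟩
  -- Since y = P⁻¹z, a row of M outside S acts on y as its incoherence vector acts on z. With ‖z‖ ≤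
  -- (1 + γ/4)β and a further γβ/4 from replacing M by its perturbation, the total is at most (1 -
  -- γ)(1 + γ/4)β + γβ/4 ≤ (1 - γ/2)β.
  set z := b - (Q - P).mulVec y with hz
  have hyz : y = P⁻¹.mulVec z := by
    conv_lhs => rw [hinv y, hy]
  have hzn : ‖z‖ ≤ β + S.card * ε * ‖y‖ :=
    (norm_sub_le _ _).trans (add_le_add hbn (hE y))
  have h1 : |∑ l : S, M i l * y l| ≤ (1 - γ) * ‖z‖ := by
    have e1 : ∑ l : S, M i l * y l =
        ∑ l, Matrix.vecMul (fun a : S => M i a) P⁻¹ l * z l := by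
      change (fun a : S => M i a) ⬝ᵥ y = Matrix.vecMul (fun a : S => M i a) P⁻¹ ⬝ᵥ z
      rw [← Matrix.dotProduct_mulVec, ← hyz]
    rw [e1]
    refine (Finset.abs_sum_le_sum_abs _ _).trans ?_
    calc _ ≤ ∑ l, |Matrix.vecMul (fun a : S => M i a) P⁻¹ l| * ‖z‖ := by
          refine Finset.sum_le_sum fun l _ => ?_
          rw [abs_mul]
          gcongr
          exact norm_le_pi_norm z l
      _ ≤ _ := by
          rw [← Finset.sum_mul]
          gcongr
          exact hinc i hi
  have h2 : |∑ l : S, (Mh i l - M i l) * y l| ≤ S.card * ε * ‖y‖ := by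
    rw [← hcard]
    exact abs_sum_mul_le_of_entry_le (fun l : S => hε i l) y
  have h3 : ∑ l : S, Mh i l * y l =
      ∑ l : S, M i l * y l + ∑ l : S, (Mh i l - M i l) * y l := by
    rw [← Finset.sum_add_distrib]
    exact Finset.sum_congr rfl fun l _ => by ring
  have hε0 : 0 ≤ ε := (abs_nonneg _).trans (hε i i)
  have hkε : 0 ≤ S.card * ε := mul_nonneg (Nat.cast_nonneg _) hε0
  have h4 : S.card * ε * ‖y‖ ≤ γ / 4 * β := by
    calc S.card * ε * ‖y‖ ≤ S.card * ε * (2 * D * β) := mul_le_mul_of_nonneg_left hyn hkε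
      _ = 2 * (D * S.card * ε) * β := by ring
      _ ≤ 2 * (γ / 8) * β := by gcongr
      _ = _ := by ring
  have h5 : 0 ≤ S.card * ε * ‖y‖ := mul_nonneg hkε (norm_nonneg y)
  rw [h3]
  refine (abs_add_le _ _).trans ((add_le_add h1 h2).trans ?_)
  have h6 : (1 - γ) * ‖z‖ ≤ (1 - γ) * (β + S.card * ε * ‖y‖) := by
    gcongr
  nlinarith

end Perturbation

/-! ### Dual certificates for the Lasso -/

section Certificate

variable {n m T : ℕ}

/-- Negative gradient of the quadratic part of the Lasso objective. -/
noncomputable def lassoGrad (Y : Matrix (Fin T) (Fin n) ℝ) (X : Matrix (Fin T) (Fin n ⊕ Fin m) ℝ)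
    (Ψ : Matrix (Fin n ⊕ Fin m) (Fin n) ℝ) (i : Fin n ⊕ Fin m) (j : Fin n) : ℝ :=
  1 / (T : ℝ) * ∑ t, X t i * (Y - X * Ψ) t j

/-- Exact expansion of the quadratic about Ψ; complementary slackness cancels the terms linear in Ψ.
If the gradient is bounded by lam, both extra terms are nonnegative, so optimality and the equality
case can be read off. -/
lemma lassoObj_eq_add (Y : Matrix (Fin T) (Fin n) ℝ) (X : Matrix (Fin T) (Fin n ⊕ Fin m) ℝ)
    (lam : ℝ) (Ψ Φ : Matrix (Fin n ⊕ Fin m) (Fin n) ℝ)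
    (hG : ∀ i j, lassoGrad Y X Ψ i j * Ψ i j = lam * |Ψ i j|) :
    lassoObj Y X lam Φ = lassoObj Y X lam Ψ +
      (1 / (2 * (T : ℝ)) * ∑ t, ∑ j, (X * (Φ - Ψ)) t j ^ 2 +
        ∑ i, ∑ j, (lam * |Φ i j| - lassoGrad Y X Ψ i j * Φ i j)) := by
  have e1 : ∀ t j, (Y - X * Φ) t j ^ 2 = (Y - X * Ψ) t j ^ 2 + (X * (Φ - Ψ)) t j ^ 2 -
      2 * ((Y - X * Ψ) t j * (X * (Φ - Ψ)) t j) := by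
    intro t j
    rw [Matrix.mul_sub]
    simp only [Matrix.sub_apply]
    ring
  have e2 : 1 / (T : ℝ) * ∑ t, ∑ j, (Y - X * Ψ) t j * (X * (Φ - Ψ)) t j =
      ∑ i, ∑ j, lassoGrad Y X Ψ i j * (Φ i j - Ψ i j) := by
    have e3 : ∀ t j, (Y - X * Ψ) t j * (X * (Φ - Ψ)) t j =
        ∑ i, X t i * (Y - X * Ψ) t j * (Φ i j - Ψ i j) := by
      intro t j
      rw [Matrix.mul_apply, Finset.mul_sum]
      refine Finset.sum_congr rfl fun i _ => ?_
      rw [Matrix.sub_apply Φ]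
      ring
    simp_rw [e3, lassoGrad]
    rw [Finset.sum_comm, Finset.mul_sum, Finset.sum_comm (s := Finset.univ (α := Fin n ⊕ Fin m))]
    refine Finset.sum_congr rfl fun j _ => ?_
    rw [Finset.sum_comm, Finset.mul_sum]
    refine Finset.sum_congr rfl fun i _ => ?_
    rw [mul_assoc, Finset.sum_mul]
  have e4 : ∑ i, ∑ j, lassoGrad Y X Ψ i j * (Φ i j - Ψ i j) =
      ∑ i, ∑ j, lassoGrad Y X Ψ i j * Φ i j - lam * ∑ i, ∑ j, |Ψ i j| := by
    simp_rw [mul_sub, hG, Finset.mul_sum, Finset.sum_sub_distrib]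
  rw [e4] at e2
  simp only [lassoObj, e1, Finset.sum_add_distrib, Finset.sum_sub_distrib, ← Finset.mul_sum]
  have e5 : ∀ z : ℝ, 1 / (2 * (T : ℝ)) * (2 * z) = 1 / (T : ℝ) * z := by
    intro z
    rcases eq_or_ne (T : ℝ) 0 with h | h
    · simp [h]
    · field_simp
  rw [mul_sub, mul_add, e5, e2]
  ring

/-- A minimizer makes both nonnegative gap terms vanish. Strict dual feasibility off S then kills
its entries there, the quadratic term gives X(Φ - Ψ) = 0, and injectivity of X on matrices supported
in S gives Φ = Ψ. -/
lemma isLassoSolution_iff_of_certificate {Y : Matrix (Fin T) (Fin n) ℝ}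
    {X : Matrix (Fin T) (Fin n ⊕ Fin m) ℝ} {lam : ℝ} {Ψ : Matrix (Fin n ⊕ Fin m) (Fin n) ℝ}
    (S : Fin n → Finset (Fin n ⊕ Fin m))
    (hoff : ∀ j, ∀ i ∉ S j, |lassoGrad Y X Ψ i j| < lam)
    (hon : ∀ j, ∀ i ∈ S j, |lassoGrad Y X Ψ i j| ≤ lam)
    (hG : ∀ i j, lassoGrad Y X Ψ i j * Ψ i j = lam * |Ψ i j|)
    (hinj : ∀ R : Matrix (Fin n ⊕ Fin m) (Fin n) ℝ, (∀ j, ∀ i ∉ S j, R i j = 0) →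
      (∀ t j, (X * R) t j = 0) → R = 0) (hT : 0 < T)
    (Φ : Matrix (Fin n ⊕ Fin m) (Fin n) ℝ) :
    IsLassoSolution Y X lam Φ ↔ Φ = Ψ := by
  have hT' : (0 : ℝ) < T := by exact_mod_cast hT
  have hle : ∀ i j, |lassoGrad Y X Ψ i j| ≤ lam := fun i j => by
    by_cases h : i ∈ S j
    · exact hon j i h
    · exact (hoff j i h).le
  have hterm : ∀ (Φ : Matrix (Fin n ⊕ Fin m) (Fin n) ℝ) i j,
      0 ≤ lam * |Φ i j| - lassoGrad Y X Ψ i j * Φ i j := by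
    intro Φ i j
    have h1 : lassoGrad Y X Ψ i j * Φ i j ≤ |lassoGrad Y X Ψ i j| * |Φ i j| := by
      rw [← abs_mul]; exact le_abs_self _
    have h2 : |lassoGrad Y X Ψ i j| * |Φ i j| ≤ lam * |Φ i j| := by
      gcongr
      exact hle i j
    linarith
  have hquad : ∀ Φ : Matrix (Fin n ⊕ Fin m) (Fin n) ℝ,
      0 ≤ 1 / (2 * (T : ℝ)) * ∑ t, ∑ j, (X * (Φ - Ψ)) t j ^ 2 := fun Φ => by positivity
  have hlin : ∀ Φ : Matrix (Fin n ⊕ Fin m) (Fin n) ℝ,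
      0 ≤ ∑ i, ∑ j, (lam * |Φ i j| - lassoGrad Y X Ψ i j * Φ i j) := fun Φ =>
    Finset.sum_nonneg fun i _ => Finset.sum_nonneg fun j _ => hterm Φ i j
  constructor
  · intro hΦ
    have h1 := hΦ Ψ
    rw [lassoObj_eq_add Y X lam Ψ Φ hG] at h1
    have h2 : ∑ i, ∑ j, (lam * |Φ i j| - lassoGrad Y X Ψ i j * Φ i j) = 0 :=
      le_antisymm (by linarith [hquad Φ]) (hlin Φ)
    have h3 : 1 / (2 * (T : ℝ)) * ∑ t, ∑ j, (X * (Φ - Ψ)) t j ^ 2 = 0 :=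
      le_antisymm (by linarith [hlin Φ]) (hquad Φ)
    have hz : ∀ (Θ : Matrix (Fin n ⊕ Fin m) (Fin n) ℝ),
        ∑ i, ∑ j, (lam * |Θ i j| - lassoGrad Y X Ψ i j * Θ i j) = 0 →
        ∀ j, ∀ i ∉ S j, Θ i j = 0 := by
      intro Θ h2 j i hi
      have h4 := (Finset.sum_eq_zero_iff_of_nonneg fun i _ =>
        Finset.sum_nonneg fun j _ => hterm Θ i j).1 h2 i (Finset.mem_univ i)
      have h5 := (Finset.sum_eq_zero_iff_of_nonneg fun j _ => hterm Θ i j).1 h4 j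
        (Finset.mem_univ j)
      have h6 : lassoGrad Y X Ψ i j * Θ i j ≤ |lassoGrad Y X Ψ i j| * |Θ i j| := by
        rw [← abs_mul]; exact le_abs_self _
      have h7 := hoff j i hi
      by_contra hne
      have := abs_pos.2 hne
      nlinarith
    have h8 : ∑ i, ∑ j, (lam * |Ψ i j| - lassoGrad Y X Ψ i j * Ψ i j) = 0 :=
      Finset.sum_eq_zero fun i _ => Finset.sum_eq_zero fun j _ => by rw [hG, sub_self]
    refine sub_eq_zero.1 (hinj (Φ - Ψ) (fun j i hi => ?_) fun t j => ?_)
    · rw [Matrix.sub_apply, hz Φ h2 j i hi, hz Ψ h8 j i hi, sub_zero]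
    · have h9 : ∑ t, ∑ j, (X * (Φ - Ψ)) t j ^ 2 = 0 := by
        rcases mul_eq_zero.1 h3 with h | h
        · exact absurd h (by positivity)
        · exact h
      have h10 := (Finset.sum_eq_zero_iff_of_nonneg fun t _ =>
        Finset.sum_nonneg fun j _ => sq_nonneg _).1 h9 t (Finset.mem_univ t)
      have h11 := (Finset.sum_eq_zero_iff_of_nonneg fun j _ => sq_nonneg _).1 h10 j
        (Finset.mem_univ j)
      exact pow_eq_zero_iff two_ne_zero |>.1 h11
  · rintro rfl Θ
    rw [lassoObj_eq_add Y X lam Φ Θ hG]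
    linarith [hquad Θ, hlin Θ]

end Certificate

end SparseLTI

/-! ### Support recovery by the primal-dual witness -/

namespace SparseLTI

lemma mem_colSupport {n m : ℕ} {Ψ : Matrix (Fin n ⊕ Fin m) (Fin n) ℝ} {i : Fin n ⊕ Fin m}
    {j : Fin n} : i ∈ colSupport Ψ j ↔ Ψ i j ≠ 0 := by
  simp [colSupport]

/-- Empirical second moment matrix of the rows of `X`. -/
noncomputable def gram {κ : Type*} {T : ℕ} (X : Matrix (Fin T) κ ℝ) : Matrix κ κ ℝ :=
  fun i l => 1 / (T : ℝ) * ∑ t, X t i * X t l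

lemma sum_gram_mul {κ ν : Type*} [Fintype κ] {T : ℕ} (X : Matrix (Fin T) κ ℝ)
    (S : Finset κ) (R : Matrix κ ν ℝ) (j : ν) (hR : ∀ i ∉ S, R i j = 0) (i : κ) :
    ∑ l : S, gram X i l * R l j = 1 / (T : ℝ) * ∑ t, X t i * (X * R) t j := by
  have h1 : ∑ l : S, gram X i l * R l j = ∑ l, gram X i l * R l j := by
    rw [Finset.sum_coe_sort S (fun l => gram X i l * R l j)]
    exact Finset.sum_subset (Finset.subset_univ S) fun l _ hl => by rw [hR l hl, mul_zero]
  rw [h1]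
  simp only [gram, Matrix.mul_apply, Finset.mul_sum, Finset.sum_mul]
  rw [Finset.sum_comm]
  exact Finset.sum_congr rfl fun t _ => Finset.sum_congr rfl fun l _ => by ring

/-- The witness is Ψ + Δ, where Δ is supported on 𝒜_j in column j and solves the restricted
stationarity equation there. The gap condition keeps the signs of Ψ, so the prescribed signs are a
genuine subgradient. -/
lemma lasso_support_recovery {n m T k : ℕ} {X : Matrix (Fin T) (Fin n ⊕ Fin m) ℝ}
    {Ψ : Matrix (Fin n ⊕ Fin m) (Fin n) ℝ} {W Y : Matrix (Fin T) (Fin n) ℝ}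
    {M : Matrix (Fin n ⊕ Fin m) (Fin n ⊕ Fin m) ℝ} {γ Cmin Dmax Ψmin ε lam : ℝ}
    (hY : Y = X * Ψ + W) (hM : MutualIncoherence M Ψ γ Cmin Dmax Ψmin)
    (hk : ∀ j, (colSupport Ψ j).card ≤ k) (hT : 0 < T) (hlam : 0 < lam) (hε : 0 ≤ ε)
    (hgram : ∀ i l, |gram X i l - M i l| ≤ ε)
    (hnoise : ∀ i j, |1 / (T : ℝ) * ∑ t, X t i * W t j| ≤ γ * lam / 4)
    (hsmall : Dmax * k * ε ≤ γ / 8) (hgap : 5 / 2 * Dmax * lam < Ψmin) :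
    ∃ Ψhat : Matrix (Fin n ⊕ Fin m) (Fin n) ℝ,
      (∀ Φ, IsLassoSolution Y X lam Φ ↔ Φ = Ψhat) ∧
      (∀ i j, Ψhat i j ≠ 0 ↔ Ψ i j ≠ 0) ∧
      (∀ i j, |Ψhat i j - Ψ i j| ≤ 5 / 2 * Dmax * lam) := by
  have hγ0 := hM.gamma_pos
  have hγ1 := hM.gamma_lt_one
  have hD : 0 ≤ Dmax := zero_le_one.trans hM.one_le_Dmax
  have hsol := fun j => exists_solution_of_entrywise_close (M := M) (Mh := gram X)
    (S := colSupport Ψ j) (D := Dmax) (ε := ε) (γ := γ) (by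
      by_contra hnu
      have h0 : (0 : ℝ) ∈ spectrum ℝ (principalSub M (colSupport Ψ j)) := by
        rwa [spectrum.zero_mem_iff]
      linarith [hM.eigenvalue j 0 h0, hM.Cmin_pos]) (hM.infNorm j) (hM.incoherence j) hgram hγ0 hγ1
      hD (by
        refine le_trans ?_ hsmall
        have : ((colSupport Ψ j).card : ℝ) ≤ k := by exact_mod_cast hk j
        gcongr)
  set ξ : Fin n ⊕ Fin m → Fin n → ℝ := fun i j => 1 / (T : ℝ) * ∑ t, X t i * W t j with hξ
  -- Bound for the right-hand side: noise at most γλ/4 plus a sign vector scaled by λ. Then 2 D_max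
  -- β ≤ (5/2) D_max λ because γ < 1.
  set β := (1 + γ / 4) * lam with hβ
  have hβ0 : 0 ≤ β := by positivity
  have hsign : ∀ z : ℝ, |(SignType.sign z : ℝ)| ≤ 1 := by
    intro z
    rcases lt_trichotomy z 0 with h | h | h <;> simp [h]
  choose y hy1 hy2 hy3 using fun j => (hsol j).2
    (fun i => ξ i j - lam * (SignType.sign (Ψ i j) : ℝ)) β (fun i => by
      refine (abs_sub _ _).trans ?_
      rw [abs_mul lam, abs_of_pos hlam]
      have h1 := hnoise i j
      have h2 := mul_le_mul_of_nonneg_left (hsign (Ψ i j)) hlam.le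
      simp only [hβ]
      linarith) hβ0
  set Δ : Matrix (Fin n ⊕ Fin m) (Fin n) ℝ :=
    fun i j => if h : i ∈ colSupport Ψ j then y j ⟨i, h⟩ else 0 with hΔ
  have hΔon : ∀ j (i : colSupport Ψ j), Δ i j = y j i := fun j i => by simp [hΔ]
  have hΔoff : ∀ j, ∀ i ∉ colSupport Ψ j, Δ i j = 0 := fun j i hi => by simp [hΔ, hi]
  have hbd : ∀ i j, |Δ i j| ≤ 5 / 2 * Dmax * lam := by
    intro i j
    by_cases hi : i ∈ colSupport Ψ j
    · rw [hΔon j ⟨i, hi⟩]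
      refine (hy2 j _).trans ?_
      have h3 : 2 * Dmax * β = (2 + γ / 2) * (Dmax * lam) := by rw [hβ]; ring
      rw [h3]
      have : 0 ≤ Dmax * lam := by positivity
      nlinarith
    · rw [hΔoff j i hi, abs_zero]
      positivity
  have hgrad : ∀ i j, lassoGrad Y X (Ψ + Δ) i j =
      ξ i j - ∑ l : colSupport Ψ j, gram X i l * y j l := by
    intro i j
    simp_rw [← hΔon j]
    rw [sum_gram_mul X (colSupport Ψ j) Δ j (hΔoff j) i, hξ, lassoGrad, ← mul_sub,
      ← Finset.sum_sub_distrib]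
    congr 1
    refine Finset.sum_congr rfl fun t _ => ?_
    rw [hY, Matrix.mul_add]
    simp only [Matrix.sub_apply, Matrix.add_apply]
    ring
  have hgon : ∀ j, ∀ i ∈ colSupport Ψ j,
      lassoGrad Y X (Ψ + Δ) i j = lam * (SignType.sign (Ψ i j) : ℝ) := by
    intro j i hi
    have h1 := congrFun (hy1 j) ⟨i, hi⟩
    have h2 : (principalSub (gram X) (colSupport Ψ j)).mulVec (y j) ⟨i, hi⟩ =
      ∑ l : colSupport Ψ j, gram X i l * y j l := rfl
    rw [h2] at h1
    rw [hgrad, h1]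
    ring
  have hsgn : ∀ j, ∀ i ∈ colSupport Ψ j, (Ψ + Δ) i j ≠ 0 ∧
      (SignType.sign (Ψ i j) : ℝ) * (Ψ + Δ) i j = |(Ψ + Δ) i j| := by
    intro j i hi
    have h1 := hM.gap j i hi
    have h2 := hbd i j
    have h3 := abs_le.1 h2
    rw [Matrix.add_apply]
    rcases lt_or_gt_of_ne (mem_colSupport.1 hi) with h | h
    · rw [abs_of_neg h] at h1
      have h4 : Ψ i j + Δ i j < 0 := by linarith
      refine ⟨h4.ne, ?_⟩
      rw [abs_of_neg h4, sign_neg h]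
      simp
    · rw [abs_of_pos h] at h1
      have h4 : 0 < Ψ i j + Δ i j := by linarith
      refine ⟨h4.ne', ?_⟩
      rw [abs_of_pos h4, sign_pos h]
      simp
  have hzero : ∀ j, ∀ i ∉ colSupport Ψ j, (Ψ + Δ) i j = 0 := by
    intro j i hi
    rw [Matrix.add_apply, hΔoff j i hi, add_zero]
    by_contra h
    exact hi (mem_colSupport.2 h)
  refine ⟨Ψ + Δ, isLassoSolution_iff_of_certificate (fun j => colSupport Ψ j) ?_ ?_ ?_ ?_ hT,
    ?_, ?_⟩
  · intro j i hi
    rw [hgrad]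
    refine (abs_sub _ _).trans_lt ?_
    have h1 := hnoise i j
    have h2 := hy3 j i hi
    -- Adding the noise bound γλ/4 leaves λ(1 - γ²/8), so the off-support inequality is strict.
    have h3 : (1 - γ / 2) * β = lam - γ * lam / 4 - γ ^ 2 * lam / 8 := by rw [hβ]; ring
    rw [h3] at h2
    have : 0 < γ ^ 2 * lam := by positivity
    simp only [hξ]
    linarith
  · intro j i hi
    rw [hgon j i hi, abs_mul, abs_of_pos hlam]
    exact mul_le_of_le_one_right hlam.le (hsign _)
  · intro i j
    by_cases hi : i ∈ colSupport Ψ j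
    · rw [hgon j i hi, mul_assoc, (hsgn j i hi).2]
    · rw [hzero j i hi]
      simp
  · intro R hR hXR
    ext i j
    by_cases hi : i ∈ colSupport Ψ j
    · have h1 : (principalSub (gram X) (colSupport Ψ j)).mulVec (fun l => R l j) = 0 := by
        ext i'
        have h2 : (principalSub (gram X) (colSupport Ψ j)).mulVec (fun l => R l j) i' =
          ∑ l : colSupport Ψ j, gram X i' l * R l j := rfl
        rw [h2, sum_gram_mul X (colSupport Ψ j) R j (hR j) i']
        simp [hXR]
      exact congrFun ((hsol j).1 _ h1) ⟨i, hi⟩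
    · exact hR j i hi
  · intro i j
    rw [← mem_colSupport (Ψ := Ψ)]
    exact ⟨fun h => by_contra fun hi => h (hzero j i hi), fun hi => (hsgn j i hi).1⟩
  · intro i j
    rw [Matrix.add_apply, add_sub_cancel_left]
    exact hbd i j

lemma maxColNnz_spec {n m : ℕ} (Ψ : Matrix (Fin n ⊕ Fin m) (Fin n) ℝ) (j : Fin n) :
    (colSupport Ψ j).card ≤ maxColNnz Ψ :=
  Finset.le_sup (f := fun j => (colSupport Ψ j).card) (Finset.mem_univ j)

/-- The eigenvalue lower bound is below any upper bound of the diagonal. -/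
lemma MutualIncoherence.Cmin_le {n m : ℕ} {M : Matrix (Fin n ⊕ Fin m) (Fin n ⊕ Fin m) ℝ}
    {Ψ : Matrix (Fin n ⊕ Fin m) (Fin n) ℝ} {γ Cmin Dmax Ψmin b : ℝ}
    (hM : MutualIncoherence M Ψ γ Cmin Dmax Ψmin) (hsymm : M.IsSymm)
    (hk : 0 < maxColNnz Ψ) (hb : ∀ i, M i i ≤ b) : Cmin ≤ b := by
  obtain ⟨j, -, hj⟩ := (Finset.lt_sup_iff (s := Finset.univ)).1 hk
  set P := principalSub M (colSupport Ψ j) with hP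
  have hPh : P.IsHermitian := by
    ext a b
    simp only [Matrix.conjTranspose_apply, star_trivial, hP, principalSub, Matrix.submatrix_apply]
    exact hsymm.apply _ _
  have htr := hPh.trace_eq_sum_eigenvalues
  have h1 : ∑ _i : colSupport Ψ j, Cmin ≤ ∑ i, hPh.eigenvalues i :=
    Finset.sum_le_sum fun i _ => hM.eigenvalue j _ (hPh.eigenvalues_mem_spectrum_real i)
  have h2 : P.trace ≤ ∑ _i : colSupport Ψ j, b := Finset.sum_le_sum fun i _ => hb i
  simp only [RCLike.ofReal_real_eq_id, id] at htr
  rw [htr] at h2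
  have h3 := h1.trans h2
  simp only [Finset.sum_const, Finset.card_univ, Fintype.card_coe, nsmul_eq_mul] at h3
  exact le_of_mul_le_mul_left h3 (by exact_mod_cast hj)

end SparseLTI

/-! ### The closed loop as a moving average -/

namespace SparseLTI

/-- Apply M to its own row i: coordinate i of the result is r², so r² ≤ ‖M‖ r. -/
lemma sqrt_sum_sq_row_le_specNorm {α β : Type*} [Fintype α] [Fintype β] [DecidableEq α]
    [DecidableEq β] (M : Matrix α β ℝ) (i : α) : √(∑ l, M i l ^ 2) ≤ specNorm M := by
  set r := √(∑ l, M i l ^ 2) with hr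
  have hr0 : 0 ≤ r := Real.sqrt_nonneg _
  have hr2 : r ^ 2 = ∑ l, M i l ^ 2 := Real.sq_sqrt (Finset.sum_nonneg fun _ _ => sq_nonneg _)
  have h1 : ‖WithLp.toLp 2 (M.mulVec (M i))‖ ≤ specNorm M * ‖WithLp.toLp 2 (M i)‖ :=
    Matrix.l2_opNorm_mulVec M (WithLp.toLp 2 (M i))
  have h2 : ‖WithLp.toLp 2 (M i)‖ = r := by
    rw [EuclideanSpace.norm_eq, hr]
    simp
  have h3 : r ^ 2 ≤ ‖WithLp.toLp 2 (M.mulVec (M i))‖ := by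
    have h4 := PiLp.norm_apply_le (WithLp.toLp 2 (M.mulVec (M i))) i
    have h5 : (WithLp.toLp 2 (M.mulVec (M i))) i = r ^ 2 := by
      rw [hr2]
      simp [Matrix.mulVec, dotProduct, sq]
    rw [h5, Real.norm_eq_abs, abs_of_nonneg (sq_nonneg r)] at h4
    exact h4
  rw [h2] at h1
  rcases hr0.eq_or_lt with h0 | h0
  · rw [← h0]
    exact @norm_nonneg _ Matrix.instL2OpNormedAddCommGroup.toSeminormedAddCommGroup.toSeminormedAddGroup M
  · nlinarith

section MovingAverage

variable {Ω : Type*} [MeasurableSpace Ω] {μ : Measure Ω} {n m : ℕ}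

/-- The disturbances and input noises as one family. -/
def jointNoise (w : ℤ → Ω → Fin n → ℝ) (v : ℤ → Ω → Fin m → ℝ) (p : ℤ × (Fin n ⊕ Fin m))
    (ω : Ω) : ℝ := Sum.elim (w p.1 ω) (v p.1 ω) p.2

lemma IsNoise.isSubgaussianNoise {w : ℤ → Ω → Fin n → ℝ} {v : ℤ → Ω → Fin m → ℝ}
    [IsProbabilityMeasure μ]
    (h : IsNoise μ w v) {η : ℝ} (hη : 0 < η)
    (hw : ∀ t i, subGaussianNorm (fun ω => w t ω i) μ ≤ η)
    (hv : ∀ t i, subGaussianNorm (fun ω => v t ω i) μ ≤ η) :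
    IsSubgaussianNoise μ (jointNoise w v) (8 * η ^ 2).toNNReal
      (fun l => variance (jointNoise w v (0, l)) μ) := by
  have hc : 8 * η ^ 2 ≤ ((8 * η ^ 2).toNNReal : ℝ) := Real.le_coe_toNNReal _
  have hcent : ∀ p, IsCenteredSubGaussian (jointNoise w v p) μ := by
    rintro ⟨t, i | i⟩
    · exact h.subGaussian_w t i
    · exact h.subGaussian_v t i
  have hmeas : ∀ p, Measurable (jointNoise w v p) := by
    rintro ⟨t, i | i⟩
    · exact h.measurable_w t i
    · exact h.measurable_v t i
  refine ⟨Real.toNNReal_pos.2 (by positivity), hmeas, h.indep, ?_, fun p => (hcent p).1, ?_⟩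
  · rintro ⟨t, i | i⟩
    · exact (h.subGaussian_w t i).hasSubgaussianMGF hη (hw t i) hc
    · exact (h.subGaussian_v t i).hasSubgaussianMGF hη (hv t i) hc
  · intro p
    have h1 : variance (jointNoise w v p) μ = variance (jointNoise w v (0, p.2)) μ := by
      obtain ⟨t, i | i⟩ := p
      · exact h.variance_w t i
      · exact h.variance_v t i
    rw [← h1, variance_of_integral_eq_zero (hmeas p).aemeasurable (hcent p).1]

/-- Moving average coefficients of row `i` of `G x + g₀ e` along the closed loop `F`. -/
def closedLoopCoef {κ : Type*} (F : Matrix (Fin n) (Fin n) ℝ) (B : Matrix (Fin n) (Fin m) ℝ)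
    (G : Matrix κ (Fin n) ℝ) (g₀ : Fin n ⊕ Fin m → ℝ) (i : κ) : ℕ → Fin n ⊕ Fin m → ℝ
  | 0 => g₀
  | τ + 1 => Sum.elim ((G * F ^ τ) i) ((G * F ^ τ * B) i)

omit [MeasurableSpace Ω] in
lemma linForm_jointNoise (w : ℤ → Ω → Fin n → ℝ) (v : ℤ → Ω → Fin m → ℝ)
    (p : Fin n → ℝ) (q : Fin m → ℝ) (s : ℤ) (ω : Ω) :
    linForm (jointNoise w v) (Sum.elim p q) s ω = p ⬝ᵥ w s ω + q ⬝ᵥ v s ω := by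
  simp [linForm, jointNoise, dotProduct, Fintype.sum_sum_type]

omit [MeasurableSpace Ω] in
-- Lag 0 carries the instantaneous term g₀ and lag s + 1 carries F^s, hence N + 1 terms against N.
lemma noiseSum_closedLoopCoef {κ : Type*} (w : ℤ → Ω → Fin n → ℝ) (v : ℤ → Ω → Fin m → ℝ)
    (F : Matrix (Fin n) (Fin n) ℝ) (B : Matrix (Fin n) (Fin m) ℝ)
    (G : Matrix κ (Fin n) ℝ) (g₀ : Fin n ⊕ Fin m → ℝ) (i : κ) (N t : ℕ) (ω : Ω) :
    noiseSum (jointNoise w v) (closedLoopCoef F B G g₀ i) (N + 1) t ω =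
      G.mulVec (∑ s ∈ Finset.range N, (F ^ s).mulVec
        (w (t - 1 - s) ω + B.mulVec (v (t - 1 - s) ω))) i +
      linForm (jointNoise w v) g₀ t ω := by
  rw [noiseSum, Finset.sum_range_succ', Matrix.mulVec_sum, Finset.sum_apply]
  congr 1
  · refine Finset.sum_congr rfl fun s _ => ?_
    have h1 : (t : ℤ) - ((s + 1 : ℕ) : ℤ) = t - 1 - s := by push_cast; ring
    rw [h1, closedLoopCoef, linForm_jointNoise, Matrix.mulVec_mulVec, Matrix.mulVec_add,
      Matrix.mulVec_mulVec]
    rfl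

/-- Induction along each path from the stationary start: applying F and adding the newest noise
shifts the series by one term. A single null set serves all times. -/
lemma tendsto_state {A : Matrix (Fin n) (Fin n) ℝ} {B : Matrix (Fin n) (Fin m) ℝ}
    {K₀ : Matrix (Fin m) (Fin n) ℝ} {w : ℤ → Ω → Fin n → ℝ} {v : ℤ → Ω → Fin m → ℝ}
    {x : ℕ → Ω → Fin n → ℝ} {u : ℕ → Ω → Fin m → ℝ}
    (h : IsStationaryTrajectory μ A B K₀ w v x u) :
    ∀ᵐ ω ∂μ, ∀ t : ℕ, Tendsto (fun N : ℕ => ∑ s ∈ Finset.range N, ((A + B * K₀) ^ s).mulVec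
        (w (t - 1 - s) ω + B.mulVec (v (t - 1 - s) ω))) atTop (𝓝 (x t ω)) := by
  filter_upwards [h.initial] with ω hω t
  induction t with
  | zero =>
    have h1 : ∀ s : ℕ, ((0 : ℕ) : ℤ) - 1 - s = -((s : ℤ) + 1) := fun s => by push_cast; ring
    simp_rw [h1]
    exact hω
  | succ t ih =>
    rw [← tendsto_add_atTop_iff_nat 1]
    have e1 : ∀ N : ℕ, ∑ s ∈ Finset.range (N + 1), ((A + B * K₀) ^ s).mulVec
        (w (((t + 1 : ℕ) : ℤ) - 1 - s) ω + B.mulVec (v (((t + 1 : ℕ) : ℤ) - 1 - s) ω)) =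
        (A + B * K₀).mulVec (∑ s ∈ Finset.range N, ((A + B * K₀) ^ s).mulVec
        (w (t - 1 - s) ω + B.mulVec (v (t - 1 - s) ω))) + (w t ω + B.mulVec (v t ω)) := by
      intro N
      rw [Finset.sum_range_succ', Matrix.mulVec_sum]
      congr 1
      · refine Finset.sum_congr rfl fun s _ => ?_
        have h1 : ((t + 1 : ℕ) : ℤ) - 1 - ((s + 1 : ℕ) : ℤ) = t - 1 - s := by push_cast; ring
        rw [h1, Matrix.mulVec_mulVec, ← pow_succ']
      · simp
    simp_rw [e1]
    have e2 : x (t + 1) ω = (A + B * K₀).mulVec (x t ω) + (w t ω + B.mulVec (v t ω)) := by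
      rw [h.dynamics, h.feedback, Matrix.add_mulVec, Matrix.mulVec_add, Matrix.mulVec_mulVec]
      abel
    rw [e2]
    have hcont : Continuous fun z : Fin n → ℝ => (A + B * K₀).mulVec z := by fun_prop
    exact ((hcont.tendsto _).comp ih).add_const _

/-- Each positive lag costs at most 2Cρ^τ, one C for each noise source; the geometric series gives
2C/(1-ρ), and lag 0 adds at most 1 ≤ C/(1-ρ). -/
lemma sum_sqrt_closedLoopCoef_le {κ : Type*} [Fintype κ] [DecidableEq κ]
    {F : Matrix (Fin n) (Fin n) ℝ} {B : Matrix (Fin n) (Fin m) ℝ}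
    {G : Matrix κ (Fin n) ℝ} {g₀ : Fin n ⊕ Fin m → ℝ} {C ρ : ℝ} (hC : 1 ≤ C) (hρ0 : 0 ≤ ρ)
    (hρ1 : ρ < 1) (h1 : ∀ τ : ℕ, specNorm (G * F ^ τ) ≤ C * ρ ^ τ)
    (h2 : ∀ τ : ℕ, specNorm (G * F ^ τ * B) ≤ C * ρ ^ τ) (hg : √(∑ l, g₀ l ^ 2) ≤ 1) (i : κ)
    (N : ℕ) :
    ∑ τ ∈ Finset.range N, √(∑ l, closedLoopCoef F B G g₀ i τ l ^ 2) ≤ 3 * (C / (1 - ρ)) := by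
  have hs : 0 < 1 - ρ := by linarith
  have hgeom : ∑ τ ∈ Finset.range N, ρ ^ τ ≤ 1 / (1 - ρ) := by
    rw [le_div_iff₀ hs]
    have := geom_sum_mul ρ N
    have : 0 ≤ ρ ^ N := by positivity
    linarith
  have hrow : ∀ τ, √(∑ l, closedLoopCoef F B G g₀ i (τ + 1) l ^ 2) ≤ 2 * C * ρ ^ τ := by
    intro τ
    rw [Fintype.sum_sum_type]
    simp only [closedLoopCoef, Sum.elim_inl, Sum.elim_inr]
    have e1 := (sqrt_sum_sq_row_le_specNorm (G * F ^ τ) i).trans (h1 τ)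
    have e2 := (sqrt_sum_sq_row_le_specNorm (G * F ^ τ * B) i).trans (h2 τ)
    have hp : 0 ≤ C * ρ ^ τ := by positivity
    rw [Real.sqrt_le_left hp] at e1 e2
    refine Real.sqrt_le_iff.2 ⟨by linarith, ?_⟩
    nlinarith
  have h3 : 1 ≤ C / (1 - ρ) := by
    rw [le_div_iff₀ hs]; linarith
  calc _ ≤ ∑ τ ∈ Finset.range (N + 1), √(∑ l, closedLoopCoef F B G g₀ i τ l ^ 2) :=
        Finset.sum_le_sum_of_subset_of_nonneg (Finset.range_mono (Nat.le_succ N))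
          fun _ _ _ => Real.sqrt_nonneg _
    _ ≤ ∑ τ ∈ Finset.range N, 2 * C * ρ ^ τ + 1 := by
        rw [Finset.sum_range_succ']
        exact add_le_add (Finset.sum_le_sum fun τ _ => hrow τ) hg
    _ ≤ 2 * C * (1 / (1 - ρ)) + 1 := by
        rw [← Finset.mul_sum]
        gcongr
    _ = 2 * (C / (1 - ρ)) + 1 := by ring
    _ ≤ _ := by linarith

lemma isMovingAverage_closedLoop {κ : Type*} [Fintype κ] [DecidableEq κ]
    {A : Matrix (Fin n) (Fin n) ℝ} {B : Matrix (Fin n) (Fin m) ℝ}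
    {K₀ : Matrix (Fin m) (Fin n) ℝ} {w : ℤ → Ω → Fin n → ℝ} {v : ℤ → Ω → Fin m → ℝ}
    {x : ℕ → Ω → Fin n → ℝ} {u : ℕ → Ω → Fin m → ℝ} {C ρ : ℝ}
    (h : IsStationaryTrajectory μ A B K₀ w v x u) (hS : IsExpStable A B K₀ C ρ)
    (G : Matrix κ (Fin n) ℝ) (g₀ : Fin n ⊕ Fin m → ℝ) (i : κ)
    (h1 : ∀ τ : ℕ, specNorm (G * (A + B * K₀) ^ τ) ≤ C * ρ ^ τ)
    (h2 : ∀ τ : ℕ, specNorm (G * (A + B * K₀) ^ τ * B) ≤ C * ρ ^ τ)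
    (hg : √(∑ l, g₀ l ^ 2) ≤ 1) :
    IsMovingAverage μ (jointNoise w v) (closedLoopCoef (A + B * K₀) B G g₀ i) (3 * (C / (1 - ρ)))
      (fun t ω => G.mulVec (x t ω) i + linForm (jointNoise w v) g₀ t ω) := by
  have hs : 0 < 1 - ρ := by linarith [hS.rho_lt_one]
  have hC := hS.one_le_C
  refine ⟨by positivity, sum_sqrt_closedLoopCoef_le hC hS.rho_nonneg hS.rho_lt_one h1 h2 hg i, ?_⟩
  filter_upwards [tendsto_state h] with ω hω t
  rw [← tendsto_add_atTop_iff_nat 1]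
  simp_rw [noiseSum_closedLoopCoef]
  have hcont : Continuous fun z : Fin n → ℝ => G.mulVec z i := by
    simp only [Matrix.mulVec, dotProduct]
    fun_prop
  exact ((hcont.tendsto _).comp (hω t)).add_const _

/-- Coefficients of the joint state and input vector. -/
def stateInputCoef (A : Matrix (Fin n) (Fin n) ℝ) (B : Matrix (Fin n) (Fin m) ℝ)
    (K₀ : Matrix (Fin m) (Fin n) ℝ) : Fin n ⊕ Fin m → ℕ → Fin n ⊕ Fin m → ℝ :=
  Sum.elim (closedLoopCoef (A + B * K₀) B 1 0)
    fun i => closedLoopCoef (A + B * K₀) B K₀ (Sum.elim 0 (Pi.single i 1)) i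

/-- Coefficients of the disturbance `w j`. -/
def disturbanceCoef (j : Fin n) : ℕ → Fin n ⊕ Fin m → ℝ
  | 0 => Sum.elim (Pi.single j 1) 0
  | _ + 1 => 0

lemma isMovingAverage_stateInput {A : Matrix (Fin n) (Fin n) ℝ} {B : Matrix (Fin n) (Fin m) ℝ}
    {K₀ : Matrix (Fin m) (Fin n) ℝ} {w : ℤ → Ω → Fin n → ℝ} {v : ℤ → Ω → Fin m → ℝ}
    {x : ℕ → Ω → Fin n → ℝ} {u : ℕ → Ω → Fin m → ℝ} {C ρ : ℝ}
    (h : IsStationaryTrajectory μ A B K₀ w v x u) (hS : IsExpStable A B K₀ C ρ)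
    (i : Fin n ⊕ Fin m) :
    IsMovingAverage μ (jointNoise w v) (stateInputCoef A B K₀ i) (3 * (C / (1 - ρ)))
      (fun t ω => Sum.elim (x t ω) (u t ω) i) := by
  rcases i with i | i
  · have := isMovingAverage_closedLoop h hS 1 0 i (by simpa using hS.bound)
      (by simpa using hS.bound_B) (by simp)
    simpa [linForm, stateInputCoef] using this
  · have := isMovingAverage_closedLoop h hS K₀ (Sum.elim 0 (Pi.single i 1)) i hS.bound_K
      hS.bound_KB (by simp [Pi.single_apply])
    simp_rw [linForm_jointNoise] at this
    simpa [stateInputCoef, h.feedback] using this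

lemma isMovingAverage_disturbance (w : ℤ → Ω → Fin n → ℝ) (v : ℤ → Ω → Fin m → ℝ) (j : Fin n) :
    IsMovingAverage μ (jointNoise w v) (disturbanceCoef j) 1 (fun t ω => w t ω j) := by
  refine ⟨one_pos, fun N => ?_, ae_of_all _ fun ω t => ?_⟩
  · calc _ ≤ ∑ τ ∈ Finset.range (N + 1), √(∑ l, (disturbanceCoef j τ : Fin n ⊕ Fin m → ℝ) l ^ 2) :=
          Finset.sum_le_sum_of_subset_of_nonneg (Finset.range_mono (Nat.le_succ N))
            fun _ _ _ => Real.sqrt_nonneg _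
      _ ≤ 1 := by
          rw [Finset.sum_range_succ']
          simp [disturbanceCoef, Pi.single_apply]
  · rw [← tendsto_add_atTop_iff_nat 1]
    have : ∀ N, noiseSum (jointNoise w v) (disturbanceCoef j) (N + 1) t ω = w t ω j := by
      intro N
      rw [noiseSum, Finset.sum_range_succ', disturbanceCoef, linForm_jointNoise]
      simp [disturbanceCoef, linForm]
    simp_rw [this]
    exact tendsto_const_nhds

/-- The disturbance lives at lag 0 only, where the state has no noise and the input has only its own
v. -/
lemma lagCov_stateInput_disturbance (σ : Fin n ⊕ Fin m → ℝ) (A : Matrix (Fin n) (Fin n) ℝ)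
    (B : Matrix (Fin n) (Fin m) ℝ) (K₀ : Matrix (Fin m) (Fin n) ℝ) (i : Fin n ⊕ Fin m)
    (j : Fin n) (τ : ℕ) : lagCov σ (stateInputCoef A B K₀ i) (disturbanceCoef j) τ = 0 := by
  rcases τ with _ | τ
  · rcases i with i | i <;>
      simp [lagCov, stateInputCoef, closedLoopCoef, disturbanceCoef, Fintype.sum_sum_type]
  · simp [lagCov, disturbanceCoef]

end MovingAverage

end SparseLTI

/-! ### Union bound and numerical estimates -/

namespace SparseLTI

lemma exists_measurableSet_forall_notMem {Ω κ : Type*} [MeasurableSpace Ω] {μ : Measure Ω}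
    [IsProbabilityMeasure μ] [Fintype κ] (bad : κ → Set Ω) {p δ : ℝ}
    (hδ : 0 ≤ δ)
    (h : ∀ a, μ (bad a) ≤ ENNReal.ofReal p) (hcard : Fintype.card κ * p ≤ δ) :
    ∃ E : Set Ω, MeasurableSet E ∧ ENNReal.ofReal (1 - δ) ≤ μ E ∧ ∀ ω ∈ E, ∀ a, ω ∉ bad a := by
  -- The trajectory is only almost everywhere measurable, so the bad sets need not be measurable; a
  -- measurable hull has the same measure.
  refine ⟨(toMeasurable μ (⋃ a, bad a))ᶜ, (measurableSet_toMeasurable _ _).compl, ?_, ?_⟩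
  · rw [prob_compl_eq_one_sub (measurableSet_toMeasurable _ _), measure_toMeasurable,
      ENNReal.ofReal_sub _ hδ, ENNReal.ofReal_one]
    refine tsub_le_tsub_left ?_ _
    calc μ (⋃ a, bad a) ≤ ∑ a, μ (bad a) := measure_iUnion_fintype_le _ _
      _ ≤ ∑ _a : κ, ENNReal.ofReal p := Finset.sum_le_sum fun a _ => h a
      _ = ENNReal.ofReal (Fintype.card κ * p) := by
          rw [Finset.sum_const, Finset.card_univ, nsmul_eq_mul,
            ENNReal.ofReal_mul (Nat.cast_nonneg _), ENNReal.ofReal_natCast]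
      _ ≤ ENNReal.ofReal δ := ENNReal.ofReal_le_ofReal hcard
  · intro ω hω a ha
    exact hω (subset_toMeasurable _ _ (Set.mem_iUnion.2 ⟨a, ha⟩))

lemma mul_sqrt_div_le {Q a b l T : ℝ} (hQ : 0 ≤ Q) (ha : 0 ≤ a) (hb : 0 < b) (hT : 0 < T)
    (h : Q ^ 2 * (a ^ 2 / b ^ 2) * l ≤ T) : √(l / T) * (Q * a) ≤ b := by
  rw [← Real.sqrt_sq (mul_nonneg hQ ha), ← Real.sqrt_mul' _ (sq_nonneg _)]
  refine Real.sqrt_le_iff.2 ⟨hb.le, ?_⟩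
  rw [div_mul_eq_mul_div, div_le_iff₀ hT]
  have h1 : Q ^ 2 * (a ^ 2 / b ^ 2) * l * b ^ 2 ≤ T * b ^ 2 := by gcongr
  have h2 : Q ^ 2 * (a ^ 2 / b ^ 2) * l * b ^ 2 = l * (Q * a) ^ 2 := by field_simp
  linarith

/-- With N ≥ 2, the exponent 4 gives 2N² · 2δ⁴/N⁴ = 4δ⁴/N² ≤ δ, which is why no constant is needed
in front of N/δ in the logarithm. -/
lemma card_mul_exp_log_le {N δ card : ℝ} (hN : 2 ≤ N) (h0 : 0 < δ) (h1 : δ < 1)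
    (hc : card ≤ 2 * N ^ 2) : card * (2 * Real.exp (-(4 * Real.log (N / δ)))) ≤ δ := by
  have hN0 : 0 < N := by linarith
  have hexp : Real.exp (-(4 * Real.log (N / δ))) = δ ^ 4 / N ^ 4 := by
    rw [Real.exp_neg, mul_comm, Real.exp_mul, Real.exp_log (by positivity)]
    norm_cast
    rw [div_pow, inv_div]
  rw [hexp]
  calc card * (2 * (δ ^ 4 / N ^ 4)) ≤ 2 * N ^ 2 * (2 * (δ ^ 4 / N ^ 4)) := by gcongr
    _ = 4 / N ^ 2 * δ ^ 4 := by field_simp; ring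
    _ ≤ 1 * δ := by
        gcongr
        · rw [div_le_one (by positivity)]; nlinarith
        · exact pow_le_of_le_one h0.le h1.le (by norm_num)
    _ = δ := one_mul δ

end SparseLTI

/-! ### The main theorem -/

theorem theorem1 :
    ∃ c₁ > (0 : ℝ), ∃ c₂ > (0 : ℝ), ∃ c₃ > (0 : ℝ),
      ∀ (n m : ℕ) (A : Matrix (Fin n) (Fin n) ℝ) (B : Matrix (Fin n) (Fin m) ℝ)
        (K₀ : Matrix (Fin m) (Fin n) ℝ)
        (Ω : Type*) [MeasurableSpace Ω] (μ : Measure Ω) [IsProbabilityMeasure μ]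
        (w : ℤ → Ω → Fin n → ℝ) (v : ℤ → Ω → Fin m → ℝ)
        (x : ℕ → Ω → Fin n → ℝ) (u : ℕ → Ω → Fin m → ℝ)
        (η C ρ γ Cmin Dmax Ψmin δ lam : ℝ) (k T : ℕ),
        SparseLTI.IsNoise μ w v →
        0 < η →
        (∀ t i, SparseLTI.subGaussianNorm (fun ω => w t ω i) μ ≤ η) →
        (∀ t i, SparseLTI.subGaussianNorm (fun ω => v t ω i) μ ≤ η) →
        SparseLTI.IsExpStable A B K₀ C ρ →
        SparseLTI.IsStationaryTrajectory μ A B K₀ w v x u →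
        SparseLTI.MutualIncoherence (SparseLTI.stationaryCov μ x u) (SparseLTI.trueParam A B)
          γ Cmin Dmax Ψmin →
        k = SparseLTI.maxColNnz (SparseLTI.trueParam A B) →
        2 ≤ k →
        0 < δ → δ < 1 →
        lam = c₁ * (C / (1 - ρ)) * (η ^ 2 / γ) * √(Real.log (((n : ℝ) + m) / δ) / T) →
        c₂ * (C ^ 4 / (1 - ρ) ^ 4) * (η ^ 4 * Dmax ^ 2 / (γ ^ 2 * Cmin ^ 2 * Ψmin ^ 2)) * (k : ℝ) ^ 2
          * Real.log (((n : ℝ) + m) / δ) ≤ T →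
        ∃ E : Set Ω, MeasurableSet E ∧ ENNReal.ofReal (1 - δ) ≤ μ E ∧
          ∀ ω ∈ E, ∃ Ψhat : Matrix (Fin n ⊕ Fin m) (Fin n) ℝ,
            (∀ Ψ, SparseLTI.IsLassoSolution
              (SparseLTI.obsMatrix T fun t => x t ω)
              (SparseLTI.designMatrix T (fun t => x t ω) (fun t => u t ω)) lam Ψ ↔ Ψ = Ψhat) ∧
            (∀ i j, Ψhat i j ≠ 0 ↔ SparseLTI.trueParam A B i j ≠ 0) ∧
            (∀ i j, |Ψhat i j - SparseLTI.trueParam A B i j| ≤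
              c₃ * (C / (1 - ρ)) * (Dmax * η ^ 2 / γ) *
                √(Real.log (((n : ℝ) + m) / δ) / T)) := by

  -- With c = 8η² and q = C/(1-ρ), the tail threshold 66 · 4c · Ka · Kb is 66 · 288 η²q² = 19008
  -- η²q² for second moments and 66 · 96 η²q = 6336 η²q for correlations with w, where Kb = 1.
  -- Setting γλ/4 = 6336 η²q r gives c₁ = 4 · 6336 = 25344, and c₃ = (5/2) c₁ = 63360. The number
  -- 200000 exceeds both 8 · 19008, needed for ε, and 63360, needed for the gap.
  refine ⟨25344, by norm_num, 200000 ^ 2, by norm_num, 63360, by norm_num, ?_⟩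
  intro n m A B K₀ Ω _ μ _ w v x u η C ρ γ Cmin Dmax Ψmin δ lam k T hnoise hη hw hv hS hx hM hk hk2
    hδ0 hδ1 hlam hT
  have hC := hS.one_le_C
  have hs : 0 < 1 - ρ := by linarith [hS.rho_lt_one]
  have hγ0 := hM.gamma_pos
  have hγ1 := hM.gamma_lt_one
  have hCm0 := hM.Cmin_pos
  have hCm1 := hM.Cmin_le_one
  have hD := hM.one_le_Dmax
  have hΨ0 := hM.Psimin_pos
  have hΨ1 := hM.Psimin_le_one
  set q := C / (1 - ρ) with hq
  have hq1 : 1 ≤ q := by rw [hq, le_div_iff₀ hs]; linarith [hS.rho_nonneg]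
  set N : ℝ := (n : ℝ) + m with hN
  have hcardk : ∀ j, (SparseLTI.colSupport (SparseLTI.trueParam A B) j).card ≤ k := fun j =>
    hk ▸ SparseLTI.maxColNnz_spec _ j
  have hN2 : 2 ≤ N := by
    have h1 : k ≤ n + m := by
      rw [hk]
      refine Finset.sup_le fun j _ => (Finset.card_le_univ _).trans_eq (by simp)
    have h2 : 2 ≤ n + m := hk2.trans h1
    rw [hN]
    exact_mod_cast h2
  set l := Real.log (N / δ) with hl
  have hl0 : 0 < l := by
    refine Real.log_pos ?_
    rw [lt_div_iff₀ hδ0]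
    linarith
  have hkr : (2 : ℝ) ≤ k := by exact_mod_cast hk2
  have hT0 : (0 : ℝ) < T := lt_of_lt_of_le (by positivity) hT
  set r := √(l / T) with hr
  have hr0 : 0 < r := Real.sqrt_pos.2 (by positivity)
  have hTr : T * r ^ 2 = l := by
    rw [hr, Real.sq_sqrt (by positivity)]
    field_simp
  -- The sample size condition after taking square roots; all later smallness requirements follow
  -- from it.
  have hkey : r * (200000 * (q ^ 2 * η ^ 2 * Dmax * k)) ≤ γ * Cmin * Ψmin := by
    refine SparseLTI.mul_sqrt_div_le (by norm_num) (by positivity) (by positivity) hT0 ?_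
    refine le_of_eq_of_le ?_ hT
    rw [hq]
    field_simp
  have hnz := hnoise.isSubgaussianNoise hη hw hv
  have hc : ((8 * η ^ 2).toNNReal : ℝ) = 8 * η ^ 2 := Real.coe_toNNReal _ (by positivity)
  set e := SparseLTI.jointNoise w v
  have hZ := fun i => SparseLTI.isMovingAverage_stateInput hx hS i
  have hW := fun j => SparseLTI.isMovingAverage_disturbance (μ := μ) w v j
  set M := SparseLTI.stationaryCov μ x u with hMdef
  have hcov := fun i i' => (hZ i).covariance_eq (hZ i') hnz
  have hMcov : ∀ i i', M i i' = covariance (fun ω => Sum.elim (x 0 ω) (u 0 ω) i)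
    (fun ω => Sum.elim (x 0 ω) (u 0 ω) i') μ := fun _ _ => rfl
  -- The stationary variances are at most 288 η²q². This ties C_min to the noise scale, which is
  -- what yields r ≤ 1, the range where the Chernoff bound applies.
  have hCmin : Cmin ≤ 288 * η ^ 2 * q ^ 2 := by
    refine hM.Cmin_le ?_ (by omega) fun i => ?_
    · ext i i'
      exact covariance_comm _ _
    · rw [hMcov, hcov]
      refine (le_abs_self _).trans (((hZ i).abs_tsum_lagCov_le (hZ i) hnz).trans_eq ?_)
      rw [hc]
      ring
  have hr1 : r ≤ 1 := by
    have h1 : γ * Cmin * Ψmin ≤ 1 * (288 * η ^ 2 * q ^ 2) * 1 := by gcongr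
    have h2 : r * (200000 * (q ^ 2 * η ^ 2 * 1 * 2)) ≤
        r * (200000 * (q ^ 2 * η ^ 2 * Dmax * k)) := by gcongr
    have h3 : 0 < q ^ 2 * η ^ 2 := by positivity
    by_contra hlt
    push Not at hlt
    nlinarith
  -- One bad event for each entry of the second moment matrix and one for each pair of a regressor
  -- and a disturbance coordinate.
  have hbad : ∀ a : (Fin n ⊕ Fin m) × (Fin n ⊕ Fin m) ⊕ (Fin n ⊕ Fin m) × Fin n,
      μ (Sum.elim
        (fun p => {ω | T * (19008 * η ^ 2 * q ^ 2 * r) ≤ |∑ t ∈ Finset.range T,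
          (Sum.elim (x t ω) (u t ω) p.1 * Sum.elim (x t ω) (u t ω) p.2 - M p.1 p.2)|})
        (fun p => {ω | T * (6336 * η ^ 2 * q * r) ≤ |∑ t ∈ Finset.range T,
          Sum.elim (x t ω) (u t ω) p.1 * w t ω p.2|}) a) ≤
      ENNReal.ofReal (2 * Real.exp (-(4 * l))) := by
    rintro (⟨i, i'⟩ | ⟨i, j⟩)
    · have h1 := (hZ i).measure_abs_sum_mul_ge_le (hZ i') hnz T hr0.le hr1
      rw [hTr, ← hcov i i', hc] at h1
      convert h1 using 4
      simp only [Sum.elim_inl]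
      rw [show (66 * (4 * (8 * η ^ 2) * (3 * q) * (3 * q)) * r : ℝ) =
        19008 * η ^ 2 * q ^ 2 * r by ring]
      rfl
    · have h1 := (hZ i).measure_abs_sum_mul_ge_le (hW j) hnz T hr0.le hr1
      simp_rw [SparseLTI.lagCov_stateInput_disturbance, tsum_zero, sub_zero] at h1
      rw [hTr, hc] at h1
      convert h1 using 4
      simp only [Sum.elim_inr]
      rw [show (66 * (4 * (8 * η ^ 2) * (3 * q) * 1) * r : ℝ) =
        6336 * η ^ 2 * q * r by ring]
  obtain ⟨E, hE, hEμ, hEω⟩ := SparseLTI.exists_measurableSet_forall_notMem _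
    hδ0.le hbad (by
      refine SparseLTI.card_mul_exp_log_le hN2 hδ0 hδ1 ?_
      simp only [Fintype.card_sum, Fintype.card_prod, Fintype.card_fin]
      push_cast
      have : (0 : ℝ) ≤ m := Nat.cast_nonneg m
      have : (0 : ℝ) ≤ n := Nat.cast_nonneg n
      rw [hN]
      nlinarith)
  refine ⟨E, hE, hEμ, fun ω hω => ?_⟩
  have hlam0 : 0 < lam := by rw [hlam]; positivity
  have hres := SparseLTI.lasso_support_recovery
    (X := SparseLTI.designMatrix T (fun t => x t ω) (fun t => u t ω))
    (Y := SparseLTI.obsMatrix T fun t => x t ω)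
    (W := Matrix.of fun t j => w (t : ℕ) ω j) (Ψ := SparseLTI.trueParam A B) (M := M)
    (ε := 19008 * η ^ 2 * q ^ 2 * r) (lam := lam) (k := k) (T := T) ?_ hM hcardk
    (by exact_mod_cast hT0) hlam0 (by positivity) ?_ ?_ ?_ ?_
  · obtain ⟨Ψhat, h1, h2, h3⟩ := hres
    refine ⟨Ψhat, h1, h2, fun i j => (h3 i j).trans_eq ?_⟩
    rw [hlam]
    ring
  · ext t j
    have h1 := congrFun (hx.dynamics t ω) j
    simp only [SparseLTI.obsMatrix, Matrix.of_apply, h1, Matrix.add_apply, Matrix.mul_apply,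
      SparseLTI.designMatrix, SparseLTI.trueParam, Fintype.sum_sum_type, Sum.elim_inl,
      Sum.elim_inr, Matrix.transpose_apply, Matrix.fromCols_apply_inl, Matrix.fromCols_apply_inr,
      Pi.add_apply, Matrix.mulVec, dotProduct]
    congr 2 <;> exact Finset.sum_congr rfl fun _ _ => mul_comm _ _
  · intro i i'
    have h1 := hEω ω hω (Sum.inl (i, i'))
    simp only [Sum.elim_inl, Set.mem_ofPred_eq, not_le] at h1
    rw [Finset.sum_sub_distrib, Finset.sum_const, Finset.card_range, nsmul_eq_mul] at h1
    have h2 : SparseLTI.gram (SparseLTI.designMatrix T (fun t => x t ω) (fun t => u t ω)) i i' =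
        1 / (T : ℝ) * ∑ t ∈ Finset.range T,
          Sum.elim (x t ω) (u t ω) i * Sum.elim (x t ω) (u t ω) i' := by
      rw [SparseLTI.gram, Finset.sum_range]
      rfl
    rw [h2]
    have h3 : ∀ z : ℝ, 1 / (T : ℝ) * z - M i i' = (z - T * M i i') / T := fun z => by
      field_simp
    rw [h3, abs_div, abs_of_pos hT0, div_le_iff₀ hT0]
    linarith
  · intro i j
    have h1 := hEω ω hω (Sum.inr (i, j))
    simp only [Sum.elim_inr, Set.mem_ofPred_eq, not_le] at h1
    rw [Finset.sum_range] at h1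
    rw [abs_mul, abs_of_pos (by positivity : 0 < 1 / (T : ℝ)), one_div, inv_mul_le_iff₀ hT0]
    have h2 : γ * lam / 4 = 6336 * η ^ 2 * q * r := by
      rw [hlam]
      field_simp
      ring
    rw [h2]
    exact h1.le
  · have h1 : γ * Cmin * Ψmin ≤ γ * 1 * 1 := by gcongr
    nlinarith
  · have h1 : γ * Cmin * Ψmin ≤ γ * 1 * Ψmin := by gcongr
    have h2 : r * (200000 * (q * 1 * η ^ 2 * Dmax * 1)) ≤
        r * (200000 * (q * q * η ^ 2 * Dmax * k)) := by
      gcongr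
      linarith
    have h3 : 5 / 2 * Dmax * lam * γ = 63360 * (r * (q * η ^ 2 * Dmax)) := by
      rw [hlam]
      field_simp
      ring
    refine lt_of_mul_lt_mul_right (a := γ) ?_ hγ0.le
    rw [h3]
    have h4 : 0 < r * (q * η ^ 2 * Dmax) := by positivity
    have h5 : r * (200000 * (q * 1 * η ^ 2 * Dmax * 1)) =
        200000 * (r * (q * η ^ 2 * Dmax)) := by ring
    rw [h5, ← sq] at h2
    have h6 := h2.trans (hkey.trans h1)
    rw [mul_one, mul_comm γ] at h6
    linarith only [h4, h6]
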